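/- Let $\overline\Sigma$ be a compact smooth Riemannian 3-manifold with (possibly empty) boundary $\partial\overline\Sigma$; for example, a regular Cauchy surface with boundary of a finite Cauchy lens $\overline N$ (a compact Lorentzian 4-manifold with corners), with the Riemannian metric that $\overline N$ induces on it. **Configurations.** Let $\Omega^1(\overline\Sigma)$ be the real vector space of smooth 1-forms on $\overline\Sigma$ (up to and including the boundary), $\mathrm d^*$ the codifferential, $\mathrm n_{\partial\overline\Sigma}\alpha=\alpha(\nu)\in C^\infty(\partial\overline\Sigma)$ the normal component on the boundary ($\nu$ the outward unit normal), and $$\Omega^1_{\mathrm d^*}(\overline\Sigma)=\{\alpha:\mathrm d^*\alpha=0\},\qquad \Omega^1_{\mathrm{t}\mathrm d^*}(\overline\Sigma)=\{\alpha:\mathrm d^*\alpha=0,\ \mathrm n_{\partial\overline\Sigma}\alpha=0\}.$$ Write $\langle\cdot,\cdot\rangle_{\overline\Sigma}$ and $\langle\cdot,\cdot\rangle_{\partial\overline\Sigma}$ for the $L^2$ pairings of 1-forms on $\overline\Sigma$ and of functions on $\partial\overline\Sigma$, with respect to the Riemannian volume of $\overline\Sigma$ and the induced area of $\partial\overline\Sigma$.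 Put $$V^C=\Omega^1_{\mathrm{t}\mathrm d^*}(\overline\Sigma)^{\oplus 2},\qquad V^S=\bigl(\mathrm n_{\partial\overline\Sigma}\Omega^1_{\mathrm d^*}(\overline\Sigma)\bigr)^{\oplus2},$$ $$\sigma^C(F_1\oplus H_1,F_2\oplus H_2)=\langle F_1,H_2\rangle_{\overline\Sigma}-\langle F_2,H_1\rangle_{\overline\Sigma},\qquad \sigma^S(f_1\oplus h_1,f_2\oplus h_2)=\langle f_1,h_2\rangle_{\partial\overline\Sigma}-\langle f_2,h_1\rangle_{\partial\overline\Sigma},$$ and write $\sigma=\sigma^C\oplus\sigma^S$ on $V^C\oplus V^S$. **Algebras.** For a real vector space $V$ with an alternating bilinear form $\sigma_V$, $\mathrm{Weyl}(V,\sigma_V)$ is the Weyl C*-algebra generated by unitaries $W(v)$, $v\in V$, with $W(v)^*=W(-v)$ and $W(v)W(w)=e^{-\frac i2\sigma_V(v,w)}W(v+w)$. Let $\mathscr A^C=\mathrm{Weyl}(V^C,\sigma^C)$ with generators $W^C$, $\mathscr A^S=\mathrm{Weyl}(V^S,\sigma^S)$ with generators $W^S$, and $\mathscr A^{C\oplus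 S}=\mathscr A^C\otimes\mathscr A^S$ (C*-tensor product). **Quasi-free states.** A state on $\mathscr A^{C\oplus S}$ is a continuous, positive, unital linear functional. It is called *quasi-free with associated inner product $\mu$* if $\mu$ is a real inner product on $V^C\oplus V^S$ that dominates $\sigma$, that is, $$|\sigma(v,w)|\le 2\,\|v\|_\mu\|w\|_\mu\quad\text{for all }v,w\in V^C\oplus V^S,$$ and $\omega(W^C(v^C)\otimes W^S(v^S))=\exp\bigl(-\tfrac12\|v^C\oplus v^S\|_\mu^2\bigr)$ for all $v^C\in V^C$, $v^S\in V^S$. **Theorem.** Let $$\mu_{L^2}(F\oplus H\oplus f\oplus h,\;F'\oplus H'\oplus f'\oplus h')=\tfrac12\bigl(\langle F,F'\rangle_{\overline\Sigma}+\langle H,H'\rangle_{\overline\Sigma}+\langle f,f'\rangle_{\partial\overline\Sigma}+\langle h,h'\rangle_{\partial\overline\Sigma}\bigr)$$ on $V^C\oplus V^S$. Then: 1. $\mu_{L^2}$ is a real inner product, and it dominates $\sigma$. 2. There is exactly one quasi-free state $\omega_{L^2}$ on $\mathscr A^{C\oplus S}$ whose associated inner product is $\mu_{L^2}$. 3. The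 GNS representation of $\omega_{L^2}$ is a Fock representation: there are a complex Hilbert space $\mathcal K$, a real-linear map $K:V^C\oplus V^S\to\mathcal K$ such that $K(V^C\oplus V^S)+iK(V^C\oplus V^S)$ is dense in $\mathcal K$ and $\langle Kv,Kw\rangle=\mu_{L^2}(v,w)+\tfrac i2\sigma(v,w)$ for all $v,w$, and a representation $\pi$ of $\mathscr A^{C\oplus S}$ on the bosonic Fock space over $\mathcal K$, for which the vacuum $\Omega$ is cyclic, such that $\langle\Omega,\pi(a)\Omega\rangle=\omega_{L^2}(a)$ for all $a$ and, for all $v=v^C\oplus v^S$, $\pi(W^C(v^C)\otimes W^S(v^S))=\exp\bigl(i(a(Kv)+a^*(Kv))\bigr)$, where $a$ and $a^*$ are the annihilation and creation operators. -/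

import Mathlib

open scoped Manifold ContDiff Matrix TensorProduct

/-!
# The quasi-free L² state of the Weyl algebra of closed-loop and surface configurations

First part: differential forms, codifferential, normal component and L² pairings on a compact
Riemannian 3-manifold with boundary.  Second part: Weyl algebras and tensor products as enveloping
C*-algebras.  Third part: states, quasi-free states, one-particle structures and Fock
representations.
-/

noncomputable section

namespace L2Rep

section Geometry

open Bundle Set MeasureTheory

/-- The model vector space of a 3-manifold. -/
abbrev E3 : Type := EuclideanSpace ℝ (Fin 3)

/-- Smooth Riemannian metrics on the smooth 3-manifold with boundary `M`. -/
abbrev Metric3 (M : Type*) [TopologicalSpace M] [ChartedSpace (EuclideanHalfSpace 3) M]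
    [IsManifold (𝓡∂ 3) ∞ M] : Type _ :=
  ContMDiffRiemannianMetric (𝓡∂ 3) ∞ E3 (fun p : M => TangentSpace (𝓡∂ 3) p)

/-- Smooth 1-forms on `M`: smooth sections of the cotangent bundle. -/
def OneForm (M : Type*) [TopologicalSpace M] [ChartedSpace (EuclideanHalfSpace 3) M]
    [IsManifold (𝓡∂ 3) ∞ M] : Type _ :=
  ContMDiffSection (𝓡∂ 3) (E3 →L[ℝ] ℝ) ∞ (fun p : M => TangentSpace (𝓡∂ 3) p →L[ℝ] Trivial M ℝ p)

variable {M : Type*} [TopologicalSpace M] [ChartedSpace (EuclideanHalfSpace 3) M]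
    [IsManifold (𝓡∂ 3) ∞ M]

namespace OneForm

instance : AddCommGroup (OneForm M) := inferInstanceAs
  (AddCommGroup (ContMDiffSection (𝓡∂ 3) (E3 →L[ℝ] ℝ) ∞
    (fun p : M => TangentSpace (𝓡∂ 3) p →L[ℝ] Trivial M ℝ p)))

instance : Module ℝ (OneForm M) := inferInstanceAs
  (Module ℝ (ContMDiffSection (𝓡∂ 3) (E3 →L[ℝ] ℝ) ∞
    (fun p : M => TangentSpace (𝓡∂ 3) p →L[ℝ] Trivial M ℝ p)))

/-- The covector of the 1-form `α` at the point `p`. -/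
def eval (α : OneForm M) (p : M) : TangentSpace (𝓡∂ 3) p →L[ℝ] ℝ := ContMDiffSection.toFun α p

theorem eval_add (α β : OneForm M) (p : M) : (α + β).eval p = α.eval p + β.eval p := rfl
theorem eval_smul (c : ℝ) (α : OneForm M) (p : M) : (c • α).eval p = c • α.eval p := rfl
theorem eval_zero (p : M) : (0 : OneForm M).eval p = 0 := rfl
theorem ext {α β : OneForm M} (h : ∀ p, α.eval p = β.eval p) : α = β :=
  ContMDiffSection.ext h

theorem contMDiff (α : OneForm M) :
    ContMDiff (𝓡∂ 3) ((𝓡∂ 3).prod 𝓘(ℝ, E3 →L[ℝ] ℝ)) ∞ (fun p : M =>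
      TotalSpace.mk' (E3 →L[ℝ] ℝ) (E := fun p : M => TangentSpace (𝓡∂ 3) p →L[ℝ] Trivial M ℝ p)
        p (α.eval p)) :=
  ContMDiffSection.contMDiff (I := 𝓡∂ 3) α

end OneForm


/-- The `i`-th coordinate vector at `p` of the preferred chart at `x₀` (for `p` in its source); see
`frame_eq`. -/
def frame (x₀ p : M) (i : Fin 3) : TangentSpace (𝓡∂ 3) p :=
  (trivializationAt E3 (TangentSpace (𝓡∂ 3)) x₀).symmL ℝ p (EuclideanSpace.single i 1)

theorem frame_eq {x₀ p : M} (hp : p ∈ (chartAt (EuclideanHalfSpace 3) x₀).source) (i : Fin 3) :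
    frame x₀ p i = mfderivWithin 𝓘(ℝ, E3) (𝓡∂ 3) (extChartAt (𝓡∂ 3) x₀).symm (range (𝓡∂ 3))
        (extChartAt (𝓡∂ 3) x₀ p) (EuclideanSpace.single i 1 : E3) := by
  unfold frame
  have : IsManifold (𝓡∂ 3) 1 M := IsManifold.of_le (n := ∞) (by simp)
  rw [TangentBundle.symmL_trivializationAt (I := 𝓡∂ 3) (𝕜 := ℝ) hp]
  rfl

/-- The vector `η♯` at `p` that corresponds to the covector `η` under the metric: `g(η♯, v) = η(v)`,
see `inner_sharp`. -/
def sharp (g : Metric3 M) (p : M) (η : TangentSpace (𝓡∂ 3) p →L[ℝ] ℝ) : TangentSpace (𝓡∂ 3) p :=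
  (g.inner p).inverse η

theorem smooth_frame (x₀ : M) (i : Fin 3) :
    ContMDiffOn (𝓡∂ 3) ((𝓡∂ 3).prod 𝓘(ℝ, E3)) ∞
      (fun p : M => TotalSpace.mk' E3 (E := fun p : M => TangentSpace (𝓡∂ 3) p) p (frame x₀ p i))
      (chartAt (EuclideanHalfSpace 3) x₀).source := by
  have h := (trivializationAt E3 (TangentSpace (𝓡∂ 3)) x₀).contMDiffOn_symmL (IB := 𝓡∂ 3) (n := ∞)
    (𝕜 := ℝ)
  have h2 : ContMDiffOn (𝓡∂ 3) ((𝓡∂ 3).prod 𝓘(ℝ, E3)) ∞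
      (fun p : M => TotalSpace.mk' E3 (E := Trivial M E3) p (EuclideanSpace.single i 1 : E3))
      (chartAt (EuclideanHalfSpace 3) x₀).source := by
    intro p hp
    rw [contMDiffWithinAt_totalSpace]
    exact ⟨contMDiffWithinAt_id, contMDiffWithinAt_const⟩
  exact ContMDiffOn.clm_bundle_apply (E₁ := Trivial M E3) h h2

theorem smooth_form_frame (x₀ : M) (i : Fin 3) (α : OneForm M) :
    ContMDiffOn (𝓡∂ 3) 𝓘(ℝ) ∞ (fun p => α.eval p (frame x₀ p i))
      (chartAt (EuclideanHalfSpace 3) x₀).source := by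
  have := ContMDiffOn.clm_bundle_apply (E₂ := Trivial M ℝ) (α.contMDiff.contMDiffOn) (smooth_frame x₀ i)
  intro p hp
  have h := this p hp
  rw [contMDiffWithinAt_totalSpace] at h
  exact h.2

/-- The matrix `g_{ij}` of the metric at `p` in the coordinates of the preferred chart at `x₀`. -/
def gram (g : Metric3 M) (x₀ p : M) : Matrix (Fin 3) (Fin 3) ℝ :=
  Matrix.of fun i j => g.inner p (frame x₀ p i) (frame x₀ p j)

theorem smooth_gram (g : Metric3 M) (x₀ : M) (i j : Fin 3) :
    ContMDiffOn (𝓡∂ 3) 𝓘(ℝ) ∞ (fun p => gram g x₀ p i j)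
      (chartAt (EuclideanHalfSpace 3) x₀).source := by
  have := ContMDiffOn.clm_bundle_apply₂ (E₃ := Trivial M ℝ) (b := id) (g.contMDiff.contMDiffOn)
    (smooth_frame x₀ i) (smooth_frame x₀ j)
  intro p hp
  have h := this p hp
  rw [contMDiffWithinAt_totalSpace] at h
  exact h.2


theorem isInvertible_of_pos {E : Type*} [NormedAddCommGroup E] [NormedSpace ℝ E]
    [FiniteDimensional ℝ E] (B : E →L[ℝ] E →L[ℝ] ℝ) (hB : ∀ v, v ≠ 0 → 0 < B v v) :
    B.IsInvertible := by
  let φ : E →ₗ[ℝ] Module.Dual ℝ E :=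
    { toFun := fun v => (B v : E →ₗ[ℝ] ℝ)
      map_add' := fun v w => by ext; simp
      map_smul' := fun c v => by ext; simp }
  have hinj : Function.Injective φ := by
    rw [← LinearMap.ker_eq_bot, LinearMap.ker_eq_bot']
    intro v hv
    by_contra h
    have h1 : φ v v = 0 := by rw [hv]; rfl
    exact (hB v h).ne' h1
  have hbij : Function.Bijective φ :=
    ⟨hinj, (LinearMap.injective_iff_surjective_of_finrank_eq_finrank
      (Subspace.dual_finrank_eq).symm).1 hinj⟩
  let e : E ≃ₗ[ℝ] (E →L[ℝ] ℝ) :=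
    (LinearEquiv.ofBijective φ hbij).trans LinearMap.toContinuousLinearMap
  refine ⟨e.toContinuousLinearEquiv, ?_⟩
  ext v w
  rfl

theorem metric_isInvertible (g : Metric3 M) (p : M) : (g.inner p).IsInvertible :=
  isInvertible_of_pos (E := E3) (g.inner p) (g.pos p)

theorem inner_sharp (g : Metric3 M) (p : M) (η : TangentSpace (𝓡∂ 3) p →L[ℝ] ℝ)
    (v : TangentSpace (𝓡∂ 3) p) : g.inner p (sharp g p η) v = η v := by
  unfold sharp
  rw [(metric_isInvertible g p).self_apply_inverse]

theorem exists_frame_coords {x₀ p : M} (hp : p ∈ (chartAt (EuclideanHalfSpace 3) x₀).source)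
    (v : TangentSpace (𝓡∂ 3) p) : ∃ c : Fin 3 → ℝ, v = ∑ i, c i • frame x₀ p i := by
  set e := trivializationAt E3 (TangentSpace (𝓡∂ 3)) x₀
  have hp' : p ∈ e.baseSet := by simpa [e] using hp
  have h : e.symmL ℝ p (e.continuousLinearMapAt ℝ p v) = v :=
    e.symmL_continuousLinearMapAt hp' v
  refine ⟨fun i => (show E3 from e.continuousLinearMapAt ℝ p v) i, ?_⟩
  conv_lhs => rw [← h]
  set w : E3 := e.continuousLinearMapAt ℝ p v
  have hw : w = ∑ i, w i • (EuclideanSpace.single i 1 : E3) := by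
    ext j
    simp [Finset.sum_apply, Pi.single_apply]
  conv_lhs => rw [hw]
  rw [map_sum]
  simp only [map_smul]
  rfl

theorem frame_linearIndependent {x₀ p : M} (hp : p ∈ (chartAt (EuclideanHalfSpace 3) x₀).source)
    {c : Fin 3 → ℝ} (hc : ∑ i, c i • frame x₀ p i = 0) : c = 0 := by
  set e := trivializationAt E3 (TangentSpace (𝓡∂ 3)) x₀
  have hp' : p ∈ e.baseSet := by simpa [e] using hp
  have h : ∀ w : E3, e.continuousLinearMapAt ℝ p (e.symmL ℝ p w) = w :=
    e.continuousLinearMapAt_symmL hp'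
  have h2 : e.symmL ℝ p (WithLp.toLp 2 c : E3) = 0 := by
    rw [← hc]
    have hw : (WithLp.toLp 2 c : E3) = ∑ i, c i • (EuclideanSpace.single i 1 : E3) := by
      ext j
      simp [Finset.sum_apply, Pi.single_apply]
    rw [hw, map_sum]
    simp only [map_smul]
    rfl
  have h3 := h (WithLp.toLp 2 c : E3)
  rw [h2, map_zero] at h3
  ext i
  exact (congrArg (fun w : E3 => w i) h3).symm

theorem gram_quadratic (g : Metric3 M) (x₀ p : M) (c d : Fin 3 → ℝ) :
    c ⬝ᵥ (gram g x₀ p *ᵥ d) = g.inner p (∑ i, c i • frame x₀ p i) (∑ i, d i • frame x₀ p i) := by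
  simp only [dotProduct, Matrix.mulVec, gram, Matrix.of_apply, map_sum, map_smul,
    sum_apply, smul_apply, smul_eq_mul, Finset.mul_sum]
  rw [Finset.sum_comm]
  refine Finset.sum_congr rfl fun i _ => Finset.sum_congr rfl fun j _ => ?_
  ring

theorem gram_posDef (g : Metric3 M) {x₀ p : M}
    (hp : p ∈ (chartAt (EuclideanHalfSpace 3) x₀).source) : (gram g x₀ p).PosDef := by
  refine Matrix.PosDef.of_dotProduct_mulVec_pos ?_ ?_
  · ext i j
    simp [gram, g.symm]
  · intro c hc
    simp only [star_trivial]
    rw [gram_quadratic]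
    exact g.pos _ _ fun h => hc (frame_linearIndependent hp h)

theorem apply_sharp (g : Metric3 M) {x₀ p : M}
    (hp : p ∈ (chartAt (EuclideanHalfSpace 3) x₀).source)
    (α β : TangentSpace (𝓡∂ 3) p →L[ℝ] ℝ) :
    α (sharp g p β) =
      ∑ i, ∑ j, (gram g x₀ p)⁻¹ i j * (α (frame x₀ p i) * β (frame x₀ p j)) := by
  obtain ⟨c, hc⟩ := exists_frame_coords hp (sharp g p β)
  have hb : gram g x₀ p *ᵥ c = fun i => β (frame x₀ p i) := by
    ext i
    rw [← inner_sharp g p β, hc, g.symm]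
    simp [Matrix.mulVec, dotProduct, gram, mul_comm]
  have hdet : IsUnit (gram g x₀ p).det := (gram_posDef g hp).det_pos.ne'.isUnit
  have hc2 : c = (gram g x₀ p)⁻¹ *ᵥ (fun i => β (frame x₀ p i)) := by
    rw [← hb, Matrix.mulVec_mulVec, Matrix.nonsing_inv_mul _ hdet, Matrix.one_mulVec]
  rw [hc, map_sum]
  refine Finset.sum_congr rfl fun i _ => ?_
  rw [map_smul, hc2, smul_eq_mul, Matrix.mulVec, dotProduct, Finset.sum_mul]
  refine Finset.sum_congr rfl fun j _ => ?_
  ring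

theorem smooth_det_gram (g : Metric3 M) (x₀ : M) :
    ContMDiffOn (𝓡∂ 3) 𝓘(ℝ) ∞ (fun p => (gram g x₀ p).det)
      (chartAt (EuclideanHalfSpace 3) x₀).source := by
  have h := smooth_gram g x₀
  simp only [Matrix.det_fin_three]
  exact (((((((h 0 0).mul (h 1 1)).mul (h 2 2)).sub (((h 0 0).mul (h 1 2)).mul (h 2 1))).sub
    (((h 0 1).mul (h 1 0)).mul (h 2 2))).add (((h 0 1).mul (h 1 2)).mul (h 2 0))).add
    (((h 0 2).mul (h 1 0)).mul (h 2 1))).sub (((h 0 2).mul (h 1 1)).mul (h 2 0))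

theorem smooth_sqrt_det (g : Metric3 M) (x₀ : M) :
    ContMDiffOn (𝓡∂ 3) 𝓘(ℝ) ∞ (fun p => √(gram g x₀ p).det)
      (chartAt (EuclideanHalfSpace 3) x₀).source := by
  intro p hp
  exact ((Real.contDiffAt_sqrt (gram_posDef g hp).det_pos.ne').contMDiffAt).comp_contMDiffWithinAt p
    (smooth_det_gram g x₀ p hp)

theorem smooth_adjugate_gram (g : Metric3 M) (x₀ : M) (i j : Fin 3) :
    ContMDiffOn (𝓡∂ 3) 𝓘(ℝ) ∞ (fun p => (gram g x₀ p).adjugate i j)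
      (chartAt (EuclideanHalfSpace 3) x₀).source := by
  have h := smooth_gram g x₀
  have key : ∀ a b c d e f k l : Fin 3, ContMDiffOn (𝓡∂ 3) 𝓘(ℝ) ∞
      (fun p => gram g x₀ p a b * gram g x₀ p c d - gram g x₀ p e f * gram g x₀ p k l)
      (chartAt (EuclideanHalfSpace 3) x₀).source := fun a b c d e f k l =>
    ((h a b).mul (h c d)).sub ((h e f).mul (h k l))
  have key2 : ∀ a b c d e f k l : Fin 3, ContMDiffOn (𝓡∂ 3) 𝓘(ℝ) ∞
      (fun p => -(gram g x₀ p a b * gram g x₀ p c d) + gram g x₀ p e f * gram g x₀ p k l)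
      (chartAt (EuclideanHalfSpace 3) x₀).source := fun a b c d e f k l =>
    (((h a b).mul (h c d)).neg).add ((h e f).mul (h k l))
  simp only [Matrix.adjugate_fin_three]
  fin_cases i <;> fin_cases j <;> first | exact key _ _ _ _ _ _ _ _ | exact key2 _ _ _ _ _ _ _ _

theorem smooth_gram_inv (g : Metric3 M) (x₀ : M) (i j : Fin 3) :
    ContMDiffOn (𝓡∂ 3) 𝓘(ℝ) ∞ (fun p => (gram g x₀ p)⁻¹ i j)
      (chartAt (EuclideanHalfSpace 3) x₀).source := by
  have h1 : ∀ p, (gram g x₀ p)⁻¹ i j = ((gram g x₀ p).det)⁻¹ * (gram g x₀ p).adjugate i j := by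
    intro p
    rw [Matrix.inv_def, Ring.inverse_eq_inv', Matrix.smul_apply, smul_eq_mul]
  simp only [h1]
  refine ContMDiffOn.mul ?_ (smooth_adjugate_gram g x₀ i j)
  intro p hp
  exact ((contDiffAt_inv ℝ (gram_posDef g hp).det_pos.ne').contMDiffAt).comp_contMDiffWithinAt p
    (smooth_det_gram g x₀ p hp)

theorem continuous_apply_sharp (g : Metric3 M) (α β : OneForm M) :
    Continuous fun p => α.eval p (sharp g p (β.eval p)) := by
  rw [continuous_iff_continuousAt]
  intro x₀
  have hs := (chartAt (EuclideanHalfSpace 3) x₀).open_source.mem_nhds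
    (mem_chart_source (EuclideanHalfSpace 3) x₀)
  have hc : ContinuousOn (fun p => ∑ i, ∑ j, (gram g x₀ p)⁻¹ i j *
      (α.eval p (frame x₀ p i) * β.eval p (frame x₀ p j))) (chartAt (EuclideanHalfSpace 3) x₀).source := by
    refine continuousOn_finsetSum _ fun i _ => continuousOn_finsetSum _ fun j _ => ?_
    exact (smooth_gram_inv g x₀ i j).continuousOn.mul
      ((smooth_form_frame x₀ i α).continuousOn.mul (smooth_form_frame x₀ j β).continuousOn)
  refine (hc.continuousAt hs).congr ?_
  filter_upwards [hs] with p hp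
  exact (apply_sharp g hp (α.eval p) (β.eval p)).symm


/-- The `i`-th component of the vector density `√(det g) α♯ = √(det g) g^{ij} α_j` in the coordinates
of the preferred chart at `x₀`. -/
def codiffFlux (g : Metric3 M) (x₀ : M) (α : OneForm M) (i : Fin 3) (p : M) : ℝ :=
  √(gram g x₀ p).det * ∑ j, (gram g x₀ p)⁻¹ i j * α.eval p (frame x₀ p j)

/-- The codifferential `d* α = -(det g)^{-1/2} ∂_i (√(det g) g^{ij} α_j)` of a 1-form at `x`, computed in
the preferred chart at `x`.  At boundary points the partial derivatives are those within the
half-space. -/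
def codiff (g : Metric3 M) (α : OneForm M) (x : M) : ℝ :=
  -((√(gram g x x).det)⁻¹ * ∑ i,
    fderivWithin ℝ (fun y : E3 => codiffFlux g x α i ((extChartAt (𝓡∂ 3) x).symm y))
      (range (𝓡∂ 3)) (extChartAt (𝓡∂ 3) x x) (EuclideanSpace.single i 1))

theorem smooth_codiffFlux (g : Metric3 M) (x₀ : M) (α : OneForm M) (i : Fin 3) :
    ContMDiffOn (𝓡∂ 3) 𝓘(ℝ) ∞ (codiffFlux g x₀ α i)
      (chartAt (EuclideanHalfSpace 3) x₀).source :=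
  (smooth_sqrt_det g x₀).mul (contMDiffOn_finsetSum fun j _ =>
    (smooth_gram_inv g x₀ i j).mul (smooth_form_frame x₀ j α))

theorem differentiable_codiffFlux (g : Metric3 M) (x : M) (α : OneForm M) (i : Fin 3) :
    DifferentiableWithinAt ℝ (fun y : E3 => codiffFlux g x α i ((extChartAt (𝓡∂ 3) x).symm y))
      (range (𝓡∂ 3)) (extChartAt (𝓡∂ 3) x x) := by
  have h : ContMDiffAt (𝓡∂ 3) 𝓘(ℝ) ∞ (codiffFlux g x α i) x :=
    (smooth_codiffFlux g x α i).contMDiffAt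
      ((chartAt (EuclideanHalfSpace 3) x).open_source.mem_nhds (mem_chart_source _ x))
  have h2 := (contMDiffAt_iff.1 h).2
  exact h2.differentiableWithinAt (by simp)

theorem uniqueDiff_chart (x : M) :
    UniqueDiffWithinAt ℝ (range (𝓡∂ 3)) (extChartAt (𝓡∂ 3) x x) :=
  (𝓡∂ 3).uniqueDiffOn _ (mem_range_self _)

theorem codiff_add (g : Metric3 M) (α β : OneForm M) (x : M) :
    codiff g (α + β) x = codiff g α x + codiff g β x := by
  have h : ∀ i, (fun y : E3 => codiffFlux g x (α + β) i ((extChartAt (𝓡∂ 3) x).symm y)) =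
      (fun y : E3 => codiffFlux g x α i ((extChartAt (𝓡∂ 3) x).symm y)) +
      (fun y : E3 => codiffFlux g x β i ((extChartAt (𝓡∂ 3) x).symm y)) := by
    intro i
    ext y
    simp only [codiffFlux, Pi.add_apply, OneForm.eval_add, add_apply, mul_add,
      Finset.sum_add_distrib]
  unfold codiff
  simp only [h]
  simp only [fderivWithin_add (uniqueDiff_chart x) (differentiable_codiffFlux g x α _)
    (differentiable_codiffFlux g x β _), add_apply, Finset.sum_add_distrib]
  ring

theorem codiff_smul (g : Metric3 M) (c : ℝ) (α : OneForm M) (x : M) :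
    codiff g (c • α) x = c * codiff g α x := by
  have h : ∀ i, (fun y : E3 => codiffFlux g x (c • α) i ((extChartAt (𝓡∂ 3) x).symm y)) =
      c • (fun y : E3 => codiffFlux g x α i ((extChartAt (𝓡∂ 3) x).symm y)) := by
    intro i
    ext y
    simp only [codiffFlux, Pi.smul_apply, OneForm.eval_smul, smul_apply, smul_eq_mul,
      Finset.mul_sum]
    refine Finset.sum_congr rfl fun j _ => ?_
    ring
  unfold codiff
  simp only [h]
  simp only [fderivWithin_const_smul (uniqueDiff_chart x) (differentiable_codiffFlux g x α _),
    smul_apply, smul_eq_mul, ← Finset.mul_sum]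
  ring

/-- The space of co-closed 1-forms, `d* α = 0`. -/
def coclosedForms (g : Metric3 M) : Submodule ℝ (OneForm M) where
  carrier := {α | ∀ x, codiff g α x = 0}
  add_mem' ha hb x := by rw [codiff_add, ha x, hb x, add_zero]
  zero_mem' x := by
    have h := codiff_smul g 0 (0 : OneForm M) x
    rwa [zero_smul, zero_mul] at h
  smul_mem' c α ha x := by rw [codiff_smul, ha x, mul_zero]

/-- The covector `dx⁰` at `p`, where `x⁰ ≥ 0` is the first coordinate (which defines the boundary) of
the preferred chart at `x₀`. -/
def conormal (x₀ p : M) : TangentSpace (𝓡∂ 3) p →L[ℝ] ℝ :=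
  (EuclideanSpace.proj (0 : Fin 3) : E3 →L[ℝ] ℝ).comp
    (mfderiv (𝓡∂ 3) 𝓘(ℝ, E3) (extChartAt (𝓡∂ 3) x₀) p : TangentSpace (𝓡∂ 3) p →L[ℝ] E3)

/-- The outward unit normal vector at a boundary point `p`: minus the normalised metric dual of `dx⁰`. -/
def outwardNormal (g : Metric3 M) (p : M) : TangentSpace (𝓡∂ 3) p :=
  -((√(conormal p p (sharp g p (conormal p p))))⁻¹ • sharp g p (conormal p p))

/-- The normal component `n α = α(ν)` on the boundary, where `ν` is the outward unit normal.  (For 1-forms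
on an oriented Riemannian manifold this is the inverse boundary Hodge star of the pull-back to the
boundary of `⋆ α`.) -/
def normalTrace (g : Metric3 M) : OneForm M →ₗ[ℝ] ((𝓡∂ 3).boundary M → ℝ) where
  toFun α p := α.eval p.1 (outwardNormal g p.1)
  map_add' α β := by ext p; rfl
  map_smul' c α := by ext p; rfl

theorem conormal_symmL {x₀ p : M} (hp : p ∈ (chartAt (EuclideanHalfSpace 3) x₀).source) (w : E3) :
    conormal x₀ p ((trivializationAt E3 (TangentSpace (𝓡∂ 3)) x₀).symmL ℝ p w) = w 0 := by
  have : IsManifold (𝓡∂ 3) 1 M := IsManifold.of_le (n := ∞) (by simp)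
  unfold conormal
  rw [← TangentBundle.continuousLinearMapAt_trivializationAt (I := 𝓡∂ 3) (𝕜 := ℝ) hp]
  set e := trivializationAt E3 (TangentSpace (𝓡∂ 3)) x₀
  have hp' : p ∈ e.baseSet := by simpa [e] using hp
  have h : e.continuousLinearMapAt ℝ p (e.symmL ℝ p w) = w := e.continuousLinearMapAt_symmL hp' w
  exact congrArg (fun w : E3 => w 0) h

theorem conormal_frame {x₀ p : M} (hp : p ∈ (chartAt (EuclideanHalfSpace 3) x₀).source)
    (i : Fin 3) : conormal x₀ p (frame x₀ p i) = if i = 0 then 1 else 0 := by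
  unfold frame
  rw [conormal_symmL hp]
  simp [eq_comm]

theorem boundary_coord {x₀ p : M} (hp : p ∈ (chartAt (EuclideanHalfSpace 3) x₀).source)
    (hb : p ∈ (𝓡∂ 3).boundary M) : extChartAt (𝓡∂ 3) x₀ p 0 = 0 := by
  have h := ((𝓡∂ 3).isBoundaryPoint_iff_of_mem_atlas (n := ∞) (by simp)
    (chart_mem_atlas (EuclideanHalfSpace 3) x₀) hp).1 hb
  have hr : extChartAt (𝓡∂ 3) x₀ p ∈ range (𝓡∂ 3) := mem_range_self _
  have h0 : 0 ≤ extChartAt (𝓡∂ 3) x₀ p 0 := by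
    rwa [range_modelWithCornersEuclideanHalfSpace] at hr
  by_contra hne
  have hpos : 0 < extChartAt (𝓡∂ 3) x₀ p 0 := lt_of_le_of_ne h0 (Ne.symm hne)
  have hint : extChartAt (𝓡∂ 3) x₀ p ∈ interior (range (𝓡∂ 3)) := by
    rw [interior_range_modelWithCornersEuclideanHalfSpace]
    exact hpos
  have hn : (extChartAt (𝓡∂ 3) x₀).target ∈ nhds (extChartAt (𝓡∂ 3) x₀ p) := by
    have h1 := extChartAt_target_mem_nhdsWithin' (I := 𝓡∂ 3) (x := x₀) (y := p)
      (by rw [extChartAt_source]; exact hp)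
    rwa [nhdsWithin_eq_nhds.2 (mem_interior_iff_mem_nhds.1 hint)] at h1
  exact h.2 (mem_interior_iff_mem_nhds.2 hn)

theorem conormal_proportional {x₀ p : M} (hp : p ∈ (chartAt (EuclideanHalfSpace 3) x₀).source)
    (hb : p ∈ (𝓡∂ 3).boundary M) : ∃ c : ℝ, 0 < c ∧ conormal p p = c • conormal x₀ p := by
  have : IsManifold (𝓡∂ 3) 1 M := IsManifold.of_le (n := ∞) (by simp)
  set φ := extChartAt (𝓡∂ 3) x₀ with hφ
  have hps : p ∈ φ.source := by rw [hφ, extChartAt_source]; exact hp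
  have hy0 : φ p 0 = 0 := boundary_coord hp hb
  set S := (trivializationAt E3 (TangentSpace (𝓡∂ 3)) x₀).symmL ℝ p with hS
  have hlinv : φ.symm (φ p) = p := φ.left_inv hps
  let D : E3 →L[ℝ] ℝ := (conormal p p).comp S
  -- derivative
  have hder : HasFDerivWithinAt (fun y : E3 => (extChartAt (𝓡∂ 3) p (φ.symm y)) 0) D
      (range (𝓡∂ 3)) (φ p) := by
    have h1 : HasMFDerivWithinAt 𝓘(ℝ, E3) (𝓡∂ 3) φ.symm (range (𝓡∂ 3)) (φ p)
        (mfderivWithin 𝓘(ℝ, E3) (𝓡∂ 3) φ.symm (range (𝓡∂ 3)) (φ p)) :=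
      (mdifferentiableWithinAt_extChartAt_symm (φ.map_source hps)).hasMFDerivWithinAt
    have h2 : HasMFDerivAt (𝓡∂ 3) 𝓘(ℝ, E3) (extChartAt (𝓡∂ 3) p) (φ.symm (φ p))
        (mfderiv (𝓡∂ 3) 𝓘(ℝ, E3) (extChartAt (𝓡∂ 3) p) (φ.symm (φ p))) := by
      refine (mdifferentiableAt_extChartAt ?_).hasMFDerivAt
      rw [hlinv]; exact mem_chart_source _ p
    have h3 := (HasMFDerivAt.comp_hasMFDerivWithinAt (φ p) h2 h1).hasFDerivWithinAt
    have h4 := (EuclideanSpace.proj (0 : Fin 3) : E3 →L[ℝ] ℝ).hasFDerivAt.comp_hasFDerivWithinAt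
      (φ p) h3
    refine h4.congr_fderiv ?_
    ext w
    have h5 : S w = mfderivWithin 𝓘(ℝ, E3) (𝓡∂ 3) φ.symm (range (𝓡∂ 3)) (φ p) w := by
      rw [hS, TangentBundle.symmL_trivializationAt (I := 𝓡∂ 3) (𝕜 := ℝ) hp]
      rfl
    change _ = conormal p p (S w)
    rw [h5]
    unfold conormal
    have h6 : mfderiv (𝓡∂ 3) 𝓘(ℝ, E3) (extChartAt (𝓡∂ 3) p) (φ.symm (φ p)) =
      (mfderiv (𝓡∂ 3) 𝓘(ℝ, E3) (extChartAt (𝓡∂ 3) p) p : E3 →L[ℝ] E3) := by rw [hlinv]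
    change (_ : E3) 0 = (_ : E3) 0
    rw [h6]
    rfl
  have hpos : ∀ v : E3, 0 ≤ v 0 → 0 ≤ D v := by
    intro v hv
    refine IsLocalMinOn.hasFDerivWithinAt_nonneg ?_ hder (y := v) ?_
    · refine Filter.eventually_of_mem self_mem_nhdsWithin fun y _ => ?_
      have e1 : (extChartAt (𝓡∂ 3) p (φ.symm (φ p))) 0 = 0 := by
        rw [hlinv]; exact boundary_coord (mem_chart_source _ p) hb
      have e2 : extChartAt (𝓡∂ 3) p (φ.symm y) ∈ range (𝓡∂ 3) := mem_range_self _
      rw [range_modelWithCornersEuclideanHalfSpace] at e2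
      exact e1.le.trans e2
    · refine mem_posTangentConeAt_of_segment_subset ?_
      rw [range_modelWithCornersEuclideanHalfSpace]
      refine (convex_iff_segment_subset.1 ?_) ?_ ?_
      · have := (𝓡∂ 3).convex_range
        rwa [range_modelWithCornersEuclideanHalfSpace] at this
      · exact hy0.ge
      · change 0 ≤ (φ p + v) 0
        rw [PiLp.add_apply, hy0, zero_add]; exact hv
  set c := D (EuclideanSpace.single 0 1) with hc
  have hDv : ∀ v : E3, D v = c * v 0 := by
    intro v
    have k : ∀ u : E3, u 0 = 0 → D u = 0 := fun u hu =>
      le_antisymm (by have := hpos (-u) (by simp [hu]); rw [map_neg] at this; linarith)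
        (hpos u hu.ge)
    have := k (v - v 0 • EuclideanSpace.single 0 1) (by simp)
    rw [map_sub, map_smul, sub_eq_zero] at this
    rw [this, smul_eq_mul, mul_comm]
  have hcl : conormal p p = c • conormal x₀ p := by
    ext w
    obtain ⟨d, hd⟩ := exists_frame_coords hp w
    have hw : w = S (WithLp.toLp 2 d : E3) := by
      rw [hd]
      have hw : (WithLp.toLp 2 d : E3) = ∑ i, d i • (EuclideanSpace.single i 1 : E3) := by
        ext j
        simp [Finset.sum_apply, Pi.single_apply]
      rw [hw, map_sum]
      simp only [map_smul]
      rfl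
    rw [hw, smul_apply, conormal_symmL hp]
    exact hDv _
  refine ⟨c, lt_of_le_of_ne (hpos _ (by simp)) fun h0 => ?_, hcl⟩
  have h1 := conormal_frame (mem_chart_source (EuclideanHalfSpace 3) p) (p := p) 0
  rw [hcl, ← h0] at h1
  simp at h1

theorem sharp_smul (g : Metric3 M) (p : M) (c : ℝ) (η : TangentSpace (𝓡∂ 3) p →L[ℝ] ℝ) :
    sharp g p (c • η) = c • sharp g p η := by
  unfold sharp
  rw [map_smul]

theorem normalTrace_eq (g : Metric3 M) (α : OneForm M) {x₀ : M} (p : (𝓡∂ 3).boundary M)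
    (hp : p.1 ∈ (chartAt (EuclideanHalfSpace 3) x₀).source) :
    normalTrace g α p = -((√((gram g x₀ p.1)⁻¹ 0 0))⁻¹ *
      ∑ i, (gram g x₀ p.1)⁻¹ i 0 * α.eval p.1 (frame x₀ p.1 i)) := by
  obtain ⟨c, hc, hcp⟩ := conormal_proportional hp p.2
  change α.eval p.1 (outwardNormal g p.1) = _
  unfold outwardNormal
  have e1 : conormal p.1 p.1 (sharp g p.1 (conormal p.1 p.1)) =
      c ^ 2 * (gram g x₀ p.1)⁻¹ 0 0 := by
    rw [hcp, sharp_smul, map_smul, smul_apply, apply_sharp g hp]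
    simp [conormal_frame hp]
    ring
  have e2 : α.eval p.1 (sharp g p.1 (conormal p.1 p.1)) =
      c * ∑ i, (gram g x₀ p.1)⁻¹ i 0 * α.eval p.1 (frame x₀ p.1 i) := by
    rw [hcp, sharp_smul, map_smul, apply_sharp g hp]
    simp [conormal_frame hp]
  rw [map_neg, map_smul, e1, e2, Real.sqrt_mul (sq_nonneg c), Real.sqrt_sq hc.le, smul_eq_mul]
  field_simp

theorem continuous_normalTrace (g : Metric3 M) (α : OneForm M) :
    Continuous (normalTrace g α) := by
  rw [continuous_iff_continuousAt]
  intro p₀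
  set x₀ := p₀.1
  have hs := (chartAt (EuclideanHalfSpace 3) x₀).open_source.mem_nhds
    (mem_chart_source (EuclideanHalfSpace 3) x₀)
  have hc : ContinuousOn (fun p : M => -((√((gram g x₀ p)⁻¹ 0 0))⁻¹ *
      ∑ i, (gram g x₀ p)⁻¹ i 0 * α.eval p (frame x₀ p i))) (chartAt (EuclideanHalfSpace 3) x₀).source := by
    refine ContinuousOn.neg (ContinuousOn.mul (ContinuousOn.inv₀ ?_ ?_) ?_)
    · exact (smooth_gram_inv g x₀ 0 0).continuousOn.sqrt
    · intro p hp
      exact (Real.sqrt_pos.2 (gram_posDef g hp).inv.diag_pos).ne'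
    · exact continuousOn_finsetSum _ fun i _ =>
        (smooth_gram_inv g x₀ i 0).continuousOn.mul (smooth_form_frame x₀ i α).continuousOn
  have h1 := (hc.continuousAt hs).comp (continuous_subtype_val.continuousAt (x := p₀))
  refine h1.congr ?_
  filter_upwards [continuous_subtype_val.continuousAt.preimage_mem_nhds hs] with p hp
  exact (normalTrace_eq g α p hp).symm


/-- A smooth partition of unity subordinate to the preferred charts. -/
def chartPartition (M : Type*) [TopologicalSpace M] [ChartedSpace (EuclideanHalfSpace 3) M]
    [IsManifold (𝓡∂ 3) ∞ M] [T2Space M] [CompactSpace M] : SmoothPartitionOfUnity M (𝓡∂ 3) M univ :=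
  (SmoothPartitionOfUnity.exists_isSubordinate_chartAt_source (𝓡∂ 3) M).choose

theorem chartPartition_subordinate [T2Space M] [CompactSpace M] (i : M) :
    tsupport (chartPartition M i) ⊆ (chartAt (EuclideanHalfSpace 3) i).source :=
  (SmoothPartitionOfUnity.exists_isSubordinate_chartAt_source (𝓡∂ 3) M).choose_spec i

/-- The inclusion of `ℝ²` as the boundary of the half-space `{x⁰ ≥ 0}` of `ℝ³`. -/
def boundaryEmbed (z : EuclideanSpace ℝ (Fin 2)) : E3 := !₂[0, z 0, z 1]

/-- The Riemannian volume density `√(det g_{ij})` in the preferred chart at `x₀`. -/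
def volumeDensity (g : Metric3 M) (x₀ p : M) : ℝ := √(gram g x₀ p).det

/-- The area density `√(det (g_{ab}))` (`a`, `b` tangential to the boundary) of the metric induced on the
boundary, in the preferred chart at `x₀`. -/
def areaDensity (g : Metric3 M) (x₀ p : M) : ℝ :=
  √((gram g x₀ p).submatrix Fin.succ Fin.succ).det

section Measures

variable [T2Space M] [CompactSpace M] [MeasurableSpace M]

/-- The measure on `M` given by the local densities `dens i`, put together by the partition of unity:
`A ↦ ∑ᵢ ∫ 1_A ρᵢ (dens i)`, the `i`-th integral being over the part of the chart at `i` that is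
parametrised by `j`. -/
def chartMeasure {X : Type*} [MeasureSpace X] (j : X → E3) (dens : M → M → ℝ) : Measure M :=
  Measure.sum fun i : M =>
    Measure.map (fun z => (extChartAt (𝓡∂ 3) i).symm (j z))
      ((volume.restrict (j ⁻¹' (extChartAt (𝓡∂ 3) i).target)).withDensity fun z =>
        ENNReal.ofReal (chartPartition M i ((extChartAt (𝓡∂ 3) i).symm (j z)) *
          dens i ((extChartAt (𝓡∂ 3) i).symm (j z))))

/-- The Riemannian volume measure. -/
def riemannianVolume (g : Metric3 M) : Measure M :=
  chartMeasure (id : E3 → E3) (volumeDensity g)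

/-- The Riemannian area measure of the induced metric on the boundary. -/
def boundaryArea (g : Metric3 M) : Measure ((𝓡∂ 3).boundary M) :=
  Measure.comap Subtype.val (chartMeasure boundaryEmbed (areaDensity g))

theorem measurableSet_chart_target (i : M) : MeasurableSet (extChartAt (𝓡∂ 3) i).target := by
  rw [extChartAt_target]
  exact (((chartAt (EuclideanHalfSpace 3) i).open_target.preimage
    (𝓡∂ 3).continuous_symm).measurableSet).inter (𝓡∂ 3).isClosed_range.measurableSet

theorem chartMeasure_finite {X : Type*} [MeasureSpace X] [TopologicalSpace X] [BorelSpace X]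
    [IsFiniteMeasureOnCompacts (volume : Measure X)] (j : X → E3)
    (hj : Topology.IsClosedEmbedding j) (dens : M → M → ℝ)
    (hd : ∀ i, ContinuousOn (dens i) (chartAt (EuclideanHalfSpace 3) i).source) :
    IsFiniteMeasure (chartMeasure j dens) := by
  refine ⟨?_⟩
  unfold chartMeasure
  rw [Measure.sum_apply _ MeasurableSet.univ]
  set m : M → ENNReal := fun i => Measure.map (fun z => (extChartAt (𝓡∂ 3) i).symm (j z))
      ((volume.restrict (j ⁻¹' (extChartAt (𝓡∂ 3) i).target)).withDensity fun z =>
        ENNReal.ofReal (chartPartition M i ((extChartAt (𝓡∂ 3) i).symm (j z)) *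
          dens i ((extChartAt (𝓡∂ 3) i).symm (j z)))) univ with hm
  have hle : ∀ i, m i ≤ ∫⁻ z in j ⁻¹' (extChartAt (𝓡∂ 3) i).target,
      ENNReal.ofReal (chartPartition M i ((extChartAt (𝓡∂ 3) i).symm (j z)) *
          dens i ((extChartAt (𝓡∂ 3) i).symm (j z))) := by
    intro i
    have hw := (withDensity_apply (μ := volume.restrict (j ⁻¹' (extChartAt (𝓡∂ 3) i).target))
      (fun z => ENNReal.ofReal (chartPartition M i ((extChartAt (𝓡∂ 3) i).symm (j z)) *
          dens i ((extChartAt (𝓡∂ 3) i).symm (j z)))) MeasurableSet.univ)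
    rw [Measure.restrict_univ] at hw
    rw [← hw]
    by_cases h : AEMeasurable (fun z => (extChartAt (𝓡∂ 3) i).symm (j z))
      ((volume.restrict (j ⁻¹' (extChartAt (𝓡∂ 3) i).target)).withDensity fun z =>
        ENNReal.ofReal (chartPartition M i ((extChartAt (𝓡∂ 3) i).symm (j z)) *
          dens i ((extChartAt (𝓡∂ 3) i).symm (j z))))
    · simp only [hm]
      rw [Measure.map_apply_of_aemeasurable h MeasurableSet.univ, preimage_univ]
    · simp only [hm]
      rw [Measure.map_of_not_aemeasurable h]
      simp
  have hfin : (Function.support fun i => (chartPartition M i : M → ℝ)).Finite :=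
    (chartPartition M).locallyFinite.finite_nonempty_of_compact.subset fun i hi => by
      obtain ⟨x, hx⟩ := Function.ne_iff.1 hi
      exact ⟨x, hx⟩
  have hz : ∀ i ∉ hfin.toFinset, m i = 0 := by
    intro i hi
    have h0 : ∀ x, chartPartition M i x = 0 := by
      intro x
      have : (chartPartition M i : M → ℝ) = 0 := by simpa using hi
      rw [this]; rfl
    refine le_antisymm ((hle i).trans ?_) bot_le
    simp [h0]
  rw [tsum_eq_sum hz]
  refine ENNReal.sum_lt_top.2 fun i _ => (hle i).trans_lt ?_
  set φ := extChartAt (𝓡∂ 3) i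
  set K := tsupport (chartPartition M i)
  have hKs : K ⊆ (chartAt (EuclideanHalfSpace 3) i).source := chartPartition_subordinate i
  have hK : IsCompact K := (isClosed_tsupport _).isCompact
  obtain ⟨C, hC⟩ := hK.exists_bound_of_continuousOn
    (f := fun p => chartPartition M i p * dens i p)
    ((chartPartition M i).contMDiff.continuous.continuousOn.mul ((hd i).mono hKs))
  have hφK : IsCompact (φ '' K) := hK.image_of_continuousOn
    ((continuousOn_extChartAt i).mono (by rw [extChartAt_source]; exact hKs))
  have hJ : IsCompact (j ⁻¹' (φ '' K)) := hj.isCompact_preimage hφK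
  have hJm : NullMeasurableSet (j ⁻¹' (φ '' K)) (volume : Measure X) :=
    (hφK.isClosed.preimage hj.continuous).measurableSet.nullMeasurableSet
  calc _ ≤ ∫⁻ z in j ⁻¹' φ.target, (j ⁻¹' (φ '' K)).indicator (fun _ => ENNReal.ofReal C) z := by
        refine lintegral_mono_ae ?_
        refine Filter.Eventually.mp (ae_restrict_mem₀ ?_) (Filter.Eventually.of_forall ?_)
        · exact (hj.continuous.measurable (measurableSet_chart_target i)).nullMeasurableSet
        · intro z hz
          by_cases hzK : φ.symm (j z) ∈ K
          · rw [indicator_of_mem (show z ∈ j ⁻¹' (φ '' K) from ⟨_, hzK, φ.right_inv hz⟩)]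
            exact ENNReal.ofReal_le_ofReal ((le_abs_self _).trans (hC _ hzK))
          · have : chartPartition M i (φ.symm (j z)) = 0 := image_eq_zero_of_notMem_tsupport hzK
            simp [this]
    _ ≤ ∫⁻ z, (j ⁻¹' (φ '' K)).indicator (fun _ => ENNReal.ofReal C) z :=
        lintegral_mono' Measure.restrict_le_self le_rfl
    _ = ENNReal.ofReal C * volume (j ⁻¹' (φ '' K)) := by
        rw [lintegral_indicator₀ hJm, setLIntegral_const]
    _ < ⊤ := ENNReal.mul_lt_top ENNReal.ofReal_lt_top hJ.measure_lt_top

theorem isClosedEmbedding_boundaryEmbed : Topology.IsClosedEmbedding boundaryEmbed := by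
  refine Isometry.isClosedEmbedding (Isometry.of_dist_eq fun z w => ?_)
  simp [EuclideanSpace.dist_eq, Fin.sum_univ_three, boundaryEmbed]

instance (g : Metric3 M) : IsFiniteMeasure (riemannianVolume g) :=
  chartMeasure_finite _ Topology.IsClosedEmbedding.id _ fun i => (smooth_sqrt_det g i).continuousOn

variable [BorelSpace M]

theorem isFiniteMeasure_boundaryArea (g : Metric3 M) : IsFiniteMeasure (boundaryArea g) := by
  have h : IsFiniteMeasure (chartMeasure (M := M) boundaryEmbed (areaDensity g)) := by
    refine chartMeasure_finite _ isClosedEmbedding_boundaryEmbed _ fun i => ?_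
    refine ContinuousOn.sqrt ?_
    have hg := fun a b => (smooth_gram g i a b).continuousOn
    simp only [Matrix.det_fin_two, Matrix.submatrix_apply]
    exact ((hg _ _).mul (hg _ _)).sub ((hg _ _).mul (hg _ _))
  have hc : IsClosed ((𝓡∂ 3).boundary M) := (𝓡∂ 3).isClosed_boundary (n := ∞) (by simp)
  refine ⟨?_⟩
  unfold boundaryArea
  rw [(MeasurableEmbedding.subtype_coe hc.measurableSet).comap_apply]
  exact measure_lt_top _ _

/-- The L² inner product `⟨α, β⟩ = ∫ (α, β)_g dvol` of 1-forms; `(α, β)_g = α(β♯)`. -/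
def formPairing (g : Metric3 M) (α β : OneForm M) : ℝ :=
  ∫ p, α.eval p (sharp g p (β.eval p)) ∂(riemannianVolume g)

theorem integrable_pairing (g : Metric3 M) (α β : OneForm M) :
    Integrable (fun p => α.eval p (sharp g p (β.eval p))) (riemannianVolume g) :=
  (continuous_apply_sharp g α β).integrable_of_hasCompactSupport (HasCompactSupport.of_compactSpace _)

theorem formPairing_symm (g : Metric3 M) (α β : OneForm M) :
    formPairing g α β = formPairing g β α := by
  unfold formPairing
  congr 1
  ext p
  rw [← inner_sharp g p (α.eval p), ← inner_sharp g p (β.eval p), g.symm]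

/-- `formPairing` as a bilinear form. -/
def formPairingBilin (g : Metric3 M) : OneForm M →ₗ[ℝ] OneForm M →ₗ[ℝ] ℝ :=
  LinearMap.mk₂ ℝ (formPairing g)
    (fun α α' β => by
      unfold formPairing
      rw [← integral_add (integrable_pairing g α β) (integrable_pairing g α' β)]
      rfl)
    (fun c α β => by
      unfold formPairing
      rw [smul_eq_mul, ← integral_const_mul]
      rfl)
    (fun α β β' => by
      rw [formPairing_symm, formPairing_symm g α, formPairing_symm g α β']
      unfold formPairing
      rw [← integral_add (integrable_pairing g β α) (integrable_pairing g β' α)]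
      rfl)
    (fun c α β => by
      rw [formPairing_symm, formPairing_symm g α]
      unfold formPairing
      rw [smul_eq_mul, ← integral_const_mul]
      rfl)

/-- Co-closed 1-forms with vanishing normal component on the boundary. -/
def tangentialCoclosedForms (g : Metric3 M) : Submodule ℝ (OneForm M) :=
  coclosedForms g ⊓ LinearMap.ker (normalTrace g)

/-- The space of the normal components on the boundary of all co-closed 1-forms. -/
def boundaryFluxes (g : Metric3 M) : Submodule ℝ ((𝓡∂ 3).boundary M → ℝ) :=
  (coclosedForms g).map (normalTrace g)

/-- The L² inner product of functions on the boundary. -/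
def boundaryPairing (g : Metric3 M) (f h : (𝓡∂ 3).boundary M → ℝ) : ℝ :=
  ∫ p, f p * h p ∂(boundaryArea g)

theorem integrable_boundary (g : Metric3 M) (f h : boundaryFluxes g) :
    Integrable (fun p => f.1 p * h.1 p) (boundaryArea g) := by
  have := isFiniteMeasure_boundaryArea g
  have hc : IsClosed ((𝓡∂ 3).boundary M) := (𝓡∂ 3).isClosed_boundary (n := ∞) (by simp)
  have : CompactSpace ((𝓡∂ 3).boundary M) := isCompact_iff_compactSpace.1 hc.isCompact
  have key : ∀ f : boundaryFluxes g, Continuous f.1 := by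
    rintro ⟨_, α, _, rfl⟩
    exact continuous_normalTrace g α
  exact ((key f).mul (key h)).integrable_of_hasCompactSupport (HasCompactSupport.of_compactSpace _)

theorem boundaryPairing_symm (g : Metric3 M) (f h : (𝓡∂ 3).boundary M → ℝ) :
    boundaryPairing g f h = boundaryPairing g h f := by
  unfold boundaryPairing
  simp only [mul_comm]

/-- `boundaryPairing` on `boundaryFluxes`, as a bilinear form. -/
def boundaryPairingBilin (g : Metric3 M) : boundaryFluxes g →ₗ[ℝ] boundaryFluxes g →ₗ[ℝ] ℝ :=
  LinearMap.mk₂ ℝ (fun f h => boundaryPairing g f.1 h.1)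
    (fun f f' h => by
      unfold boundaryPairing
      rw [← integral_add (integrable_boundary g f h) (integrable_boundary g f' h)]
      simp [add_mul])
    (fun c f h => by
      unfold boundaryPairing
      rw [smul_eq_mul, ← integral_const_mul]
      simp [mul_assoc])
    (fun f h h' => by
      unfold boundaryPairing
      rw [← integral_add (integrable_boundary g f h) (integrable_boundary g f h')]
      simp [mul_add])
    (fun c f h => by
      unfold boundaryPairing
      rw [smul_eq_mul, ← integral_const_mul]
      simp [mul_left_comm])

end Measures

end Geometry

section Weyl

/-- A pre-symplectic form: an alternating bilinear form on a real vector space. -/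
structure PresymplecticForm (V : Type*) [AddCommGroup V] [Module ℝ V] where
  form : V →ₗ[ℝ] V →ₗ[ℝ] ℝ
  alt : ∀ v, form v v = 0

namespace PresymplecticForm

variable {V W : Type*} [AddCommGroup V] [Module ℝ V] [AddCommGroup W] [Module ℝ W]

theorem swap (σ : PresymplecticForm V) (v w : V) : σ.form w v = -σ.form v w := by
  have h := σ.alt (v + w)
  simp only [map_add, LinearMap.add_apply, σ.alt, zero_add, add_zero] at h
  linarith

end PresymplecticForm

/-- The underlying space of the Weyl *-algebra `Δ(V, σ)`: the free complex vector space over `V`. -/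
def WeylPre {V : Type*} [AddCommGroup V] [Module ℝ V] (_σ : PresymplecticForm V) : Type _ := V →₀ ℂ

namespace WeylPre

variable {V : Type*} [AddCommGroup V] [Module ℝ V] (σ : PresymplecticForm V)

instance : AddCommGroup (WeylPre σ) := inferInstanceAs (AddCommGroup (V →₀ ℂ))
instance : Module ℂ (WeylPre σ) := inferInstanceAs (Module ℂ (V →₀ ℂ))

/-- The basis vector `W(v)`. -/
def gen (v : V) : WeylPre σ := Finsupp.single v 1

/-- The phase `exp(-(i/2) σ(v, w))`. -/
def cocycle (v w : V) : ℂ := Complex.exp (-(Complex.I / 2) * (σ.form v w : ℂ))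

/-- The product: bilinear, with `W(v) W(w) = exp(-(i/2) σ(v, w)) W(v + w)`. -/
def mulMap : WeylPre σ →ₗ[ℂ] WeylPre σ →ₗ[ℂ] WeylPre σ :=
  Finsupp.linearCombination ℂ fun v : V =>
    (Finsupp.linearCombination ℂ fun w : V => cocycle σ v w • gen σ (v + w) :
      WeylPre σ →ₗ[ℂ] WeylPre σ)

/-- The involution: antilinear, with `W(v)* = W(-v)`. -/
def starFun (a : WeylPre σ) : WeylPre σ :=
  Finsupp.mapDomain (fun v : V => -v) (Finsupp.mapRange (starRingEnd ℂ) (map_zero _) (a : V →₀ ℂ))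

theorem mulMap_gen (v w : V) :
    mulMap σ (gen σ v) (gen σ w) = cocycle σ v w • gen σ (v + w) := by
  unfold mulMap
  conv_lhs => unfold gen
  erw [Finsupp.linearCombination_single, one_smul, Finsupp.linearCombination_single, one_smul]
  rfl

theorem starFun_smul_gen (c : ℂ) (v : V) :
    starFun σ (c • gen σ v) = (starRingEnd ℂ c) • gen σ (-v) := by
  unfold starFun
  conv_lhs => unfold gen
  erw [Finsupp.smul_single, Finsupp.mapRange_single, Finsupp.mapDomain_single]
  unfold gen
  erw [Finsupp.smul_single]
  simp
  rfl

theorem starFun_zero : starFun σ 0 = 0 := by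
  simpa using starFun_smul_gen σ 0 0

theorem starFun_add (a b : WeylPre σ) : starFun σ (a + b) = starFun σ a + starFun σ b := by
  unfold starFun
  erw [Finsupp.mapRange_add (map_add _), Finsupp.mapDomain_add]
  rfl

theorem gen_induction {p : WeylPre σ → Prop} (a : WeylPre σ) (h0 : p 0)
    (hadd : ∀ a b, p a → p b → p (a + b)) (hg : ∀ (c : ℂ) v, p (c • gen σ v)) : p a := by
  refine Finsupp.induction_linear (motive := p) a h0 (fun f g hf hg => hadd f g hf hg) fun v c => ?_
  have := hg c v
  unfold gen at this
  erw [Finsupp.smul_single] at this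
  simpa using this

theorem cocycle_assoc (u v w : V) :
    cocycle σ u v * cocycle σ (u + v) w = cocycle σ v w * cocycle σ u (v + w) := by
  unfold cocycle
  rw [← Complex.exp_add, ← Complex.exp_add]
  congr 1
  simp only [map_add, LinearMap.add_apply]
  push_cast
  ring

theorem cocycle_zero_left (v : V) : cocycle σ 0 v = 1 := by simp [cocycle]
theorem cocycle_zero_right (v : V) : cocycle σ v 0 = 1 := by simp [cocycle]

theorem conj_cocycle (v w : V) : starRingEnd ℂ (cocycle σ v w) = cocycle σ (-w) (-v) := by
  unfold cocycle
  rw [← Complex.exp_conj]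
  congr 1
  simp [σ.swap v w, Complex.conj_ofNat]
  ring

instance : Mul (WeylPre σ) := ⟨fun a b => mulMap σ a b⟩
instance : One (WeylPre σ) := ⟨gen σ 0⟩

theorem mul_def (a b : WeylPre σ) : a * b = mulMap σ a b := rfl
theorem one_def : (1 : WeylPre σ) = gen σ 0 := rfl

theorem gen_mul_gen (v w : V) : gen σ v * gen σ w = cocycle σ v w • gen σ (v + w) :=
  mulMap_gen σ v w

instance : Ring (WeylPre σ) where
  left_distrib a b c := by simp only [mul_def, map_add]
  right_distrib a b c := by simp only [mul_def, map_add, LinearMap.add_apply]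
  zero_mul a := by simp only [mul_def, map_zero, LinearMap.zero_apply]
  mul_zero a := by simp only [mul_def, map_zero]
  mul_assoc a b c := by
    simp only [mul_def]
    induction a using gen_induction with
    | h0 => simp
    | hadd a a' ha ha' => simp only [map_add, LinearMap.add_apply, ha, ha']
    | hg x u =>
    induction b using gen_induction with
    | h0 => simp
    | hadd a a' ha ha' => simp only [map_add, LinearMap.add_apply, ha, ha']
    | hg y v =>
    induction c using gen_induction with
    | h0 => simp
    | hadd a a' ha ha' => simp only [map_add, ha, ha']
    | hg z w =>
    simp only [map_smul, LinearMap.smul_apply, mulMap_gen, smul_smul, add_assoc]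
    congr 1
    linear_combination (x * y * z) * cocycle_assoc σ u v w
  one_mul a := by
    simp only [mul_def, one_def]
    induction a using gen_induction with
    | h0 => simp
    | hadd a a' ha ha' => simp only [map_add, ha, ha']
    | hg x u => simp [mulMap_gen, cocycle_zero_left]
  mul_one a := by
    simp only [mul_def, one_def]
    induction a using gen_induction with
    | h0 => simp
    | hadd a a' ha ha' => simp only [map_add, LinearMap.add_apply, ha, ha']
    | hg x u => simp [mulMap_gen, cocycle_zero_right]
  neg_add_cancel := neg_add_cancel
  sub_eq_add_neg := sub_eq_add_neg
  zsmul := fun n a => n • a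
  zsmul_zero' := fun a => zero_zsmul a
  zsmul_succ' n a := SubNegMonoid.zsmul_succ' n a
  zsmul_neg' n a := SubNegMonoid.zsmul_neg' n a

instance : Algebra ℂ (WeylPre σ) :=
  Algebra.ofModule (fun r x y => by simp only [mul_def, map_smul, LinearMap.smul_apply])
    (fun r x y => by simp only [mul_def, map_smul])

instance : StarRing (WeylPre σ) where
  star := starFun σ
  star_involutive a := by
    induction a using gen_induction with
    | h0 => simp [starFun_zero]
    | hadd a a' ha ha' => rw [starFun_add, starFun_add, ha, ha']
    | hg x u => rw [starFun_smul_gen, starFun_smul_gen, neg_neg, Complex.conj_conj]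
  star_add := starFun_add σ
  star_mul a b := by
    change starFun σ (a * b) = starFun σ b * starFun σ a
    simp only [mul_def]
    induction a using gen_induction with
    | h0 => simp [starFun_zero]
    | hadd a a' ha ha' => simp only [map_add, LinearMap.add_apply, starFun_add, ha, ha']
    | hg x u =>
    induction b using gen_induction with
    | h0 => simp [starFun_zero]
    | hadd a a' ha ha' => simp only [map_add, LinearMap.add_apply, starFun_add, ha, ha']
    | hg y v =>
    simp only [map_smul, LinearMap.smul_apply, mulMap_gen, smul_smul, starFun_smul_gen,
      map_mul, conj_cocycle, neg_add_rev]
    congr 1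
    ring

theorem star_gen (v : V) : star (gen σ v) = gen σ (-v) := by
  have := starFun_smul_gen σ 1 v
  rw [one_smul, map_one, one_smul] at this
  exact this

instance : StarModule ℂ (WeylPre σ) where
  star_smul c a := by
    change starFun σ (c • a) = (starRingEnd ℂ c) • starFun σ a
    induction a using gen_induction with
    | h0 => simp [starFun_zero]
    | hadd a a' ha ha' => rw [smul_add, starFun_add, starFun_add, smul_add, ha, ha']
    | hg x u => rw [smul_smul, starFun_smul_gen, starFun_smul_gen, smul_smul, map_mul]

theorem gen_mem_unitary (v : V) : gen σ v ∈ unitary (WeylPre σ) := by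
  rw [Unitary.mem_iff, star_gen, gen_mul_gen, gen_mul_gen]
  simp [cocycle, σ.alt, one_def]

end WeylPre

/-- A unital complex *-algebra that is linearly spanned by its unitary elements. -/
class SpannedByUnitaries (B : Type*) [Ring B] [Algebra ℂ B] [StarRing B] : Prop where
  span_eq : Submodule.span ℂ (unitary B : Set B) = ⊤

instance {V : Type*} [AddCommGroup V] [Module ℝ V] (σ : PresymplecticForm V) :
    SpannedByUnitaries (WeylPre σ) where
  span_eq := by
    rw [eq_top_iff]
    rintro a -
    induction a using WeylPre.gen_induction with
    | h0 => exact zero_mem _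
    | hadd a b ha hb => exact add_mem ha hb
    | hg c v => exact Submodule.smul_mem _ _ (Submodule.subset_span (WeylPre.gen_mem_unitary σ v))

instance {A : Type*} [CStarAlgebra A] : SpannedByUnitaries A := ⟨CStarAlgebra.span_unitary A⟩

instance {A B : Type*} [Ring A] [Algebra ℂ A] [StarRing A] [StarModule ℂ A]
    [Ring B] [Algebra ℂ B] [StarRing B] [StarModule ℂ B]
    [SpannedByUnitaries A] [SpannedByUnitaries B] : SpannedByUnitaries (A ⊗[ℂ] B) where
  span_eq := by
    rw [eq_top_iff, ← TensorProduct.span_tmul_eq_top, Submodule.span_le]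
    rintro _ ⟨a, b, rfl⟩
    have ha : a ∈ Submodule.span ℂ (unitary A : Set A) := by
      rw [SpannedByUnitaries.span_eq]; trivial
    have hb : b ∈ Submodule.span ℂ (unitary B : Set B) := by
      rw [SpannedByUnitaries.span_eq]; trivial
    have := Submodule.apply_mem_map₂ (TensorProduct.mk ℂ A B) ha hb
    rw [Submodule.map₂_span_span] at this
    refine Submodule.span_mono ?_ this
    rintro _ ⟨u, hu, v, hv, rfl⟩
    simp only [SetLike.mem_coe, Unitary.mem_iff, TensorProduct.mk_apply, TensorProduct.star_tmul,
      Algebra.TensorProduct.tmul_mul_tmul] at hu hv ⊢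
    simp [hu, hv, Algebra.TensorProduct.one_def]

/-- `q` is a C*-seminorm on the *-algebra `B`. -/
structure IsCStarSeminorm {B : Type*} [Ring B] [Algebra ℂ B] [StarRing B] (q : B → ℝ) : Prop where
  nonneg : ∀ a, 0 ≤ q a
  add_le : ∀ a b, q (a + b) ≤ q a + q b
  smul : ∀ (c : ℂ) a, q (c • a) = ‖c‖ * q a
  mul_le : ∀ a b, q (a * b) ≤ q a * q b
  star_mul_self : ∀ a, q (star a * a) = q a ^ 2

section Env

variable (B : Type*) [Ring B] [Algebra ℂ B] [StarRing B]

/-- The largest C*-seminorm on `B` (the supremum is finite if `B` is spanned by unitaries). -/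
def maxCStarSeminorm (a : B) : ℝ := ⨆ q : {q : B → ℝ // IsCStarSeminorm q}, q.1 a

variable {B}

namespace IsCStarSeminorm

variable {q : B → ℝ}

theorem zero' (hq : IsCStarSeminorm q) : q 0 = 0 := by simpa using hq.smul 0 0

theorem one_le (hq : IsCStarSeminorm q) : q 1 ≤ 1 := by
  have h := hq.star_mul_self 1
  rw [star_one, one_mul] at h
  nlinarith [hq.nonneg 1]

theorem unitary_le (hq : IsCStarSeminorm q) {u : B} (hu : u ∈ unitary B) : q u ≤ 1 := by
  have h := hq.star_mul_self u
  rw [(Unitary.mem_iff.1 hu).1] at h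
  nlinarith [hq.nonneg u, hq.one_le]

theorem star' (hq : IsCStarSeminorm q) (a : B) : q (star a) = q a := by
  have key : ∀ a, q a ≤ q (star a) := fun a => by
    have h := hq.star_mul_self a
    have h2 := hq.mul_le (star a) a
    rcases (hq.nonneg a).eq_or_lt with h0 | h0
    · rw [← h0]; exact hq.nonneg _
    · nlinarith
  exact le_antisymm (by simpa using key (star a)) (key a)

end IsCStarSeminorm

theorem isCStarSeminorm_zero : IsCStarSeminorm (fun _ : B => (0 : ℝ)) where
  nonneg _ := le_rfl
  add_le _ _ := by simp
  smul _ _ := by simp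
  mul_le _ _ := by simp
  star_mul_self _ := by simp

instance : Nonempty {q : B → ℝ // IsCStarSeminorm q} := ⟨⟨_, isCStarSeminorm_zero⟩⟩

variable [SpannedByUnitaries B]

theorem bddAbove_cstarSeminorm (a : B) :
    BddAbove (Set.range fun q : {q : B → ℝ // IsCStarSeminorm q} => q.1 a) := by
  have ha : a ∈ Submodule.span ℂ (unitary B : Set B) := by
    rw [SpannedByUnitaries.span_eq]; trivial
  induction ha using Submodule.span_induction with
  | mem u hu => exact ⟨1, by rintro _ ⟨q, rfl⟩; exact q.2.unitary_le hu⟩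
  | zero => exact ⟨0, by rintro _ ⟨q, rfl⟩; exact q.2.zero'.le⟩
  | add a b _ _ ha hb =>
    obtain ⟨C, hC⟩ := ha
    obtain ⟨D, hD⟩ := hb
    refine ⟨C + D, ?_⟩
    rintro _ ⟨q, rfl⟩
    exact (q.2.add_le a b).trans (add_le_add (hC ⟨q, rfl⟩) (hD ⟨q, rfl⟩))
  | smul c a _ ha =>
    obtain ⟨C, hC⟩ := ha
    refine ⟨‖c‖ * C, ?_⟩
    rintro _ ⟨q, rfl⟩
    exact (q.2.smul c a).le.trans (mul_le_mul_of_nonneg_left (hC ⟨q, rfl⟩) (norm_nonneg c))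

theorem le_maxCStarSeminorm {q : B → ℝ} (hq : IsCStarSeminorm q) (a : B) :
    q a ≤ maxCStarSeminorm B a :=
  le_ciSup (bddAbove_cstarSeminorm a) (⟨q, hq⟩ : {q : B → ℝ // IsCStarSeminorm q})

theorem isCStarSeminorm_max : IsCStarSeminorm (maxCStarSeminorm B) where
  nonneg a := le_maxCStarSeminorm isCStarSeminorm_zero a
  add_le a b := ciSup_le fun q =>
    (q.2.add_le a b).trans (add_le_add (le_maxCStarSeminorm q.2 a) (le_maxCStarSeminorm q.2 b))
  smul c a := by
    unfold maxCStarSeminorm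
    rw [Real.mul_iSup_of_nonneg (norm_nonneg c)]
    exact iSup_congr fun q => q.2.smul c a
  mul_le a b := ciSup_le fun q => (q.2.mul_le a b).trans
    (mul_le_mul (le_maxCStarSeminorm q.2 a) (le_maxCStarSeminorm q.2 b) (q.2.nonneg b)
      (le_maxCStarSeminorm isCStarSeminorm_zero a))
  star_mul_self a := by
    have h0 : 0 ≤ maxCStarSeminorm B a := le_maxCStarSeminorm isCStarSeminorm_zero a
    apply le_antisymm
    · refine ciSup_le fun q => (q.2.star_mul_self a).le.trans ?_
      exact pow_le_pow_left₀ (q.2.nonneg a) (le_maxCStarSeminorm q.2 a) 2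
    · have h1 : 0 ≤ maxCStarSeminorm B (star a * a) :=
        le_maxCStarSeminorm isCStarSeminorm_zero _
      rw [← Real.le_sqrt h0 h1]
      refine ciSup_le fun q => ?_
      rw [Real.le_sqrt (q.2.nonneg a) h1, ← q.2.star_mul_self a]
      exact le_maxCStarSeminorm q.2 _

variable (B)

/-- A copy of `B` that carries the largest C*-seminorm. -/
def WithMaxSeminorm : Type _ := B

namespace WithMaxSeminorm

instance : Ring (WithMaxSeminorm B) := inferInstanceAs (Ring B)
instance : Algebra ℂ (WithMaxSeminorm B) := inferInstanceAs (Algebra ℂ B)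
instance : StarRing (WithMaxSeminorm B) := inferInstanceAs (StarRing B)
instance [StarModule ℂ B] : StarModule ℂ (WithMaxSeminorm B) := inferInstanceAs (StarModule ℂ B)
instance : Norm (WithMaxSeminorm B) := ⟨maxCStarSeminorm B⟩

variable {B}
theorem norm_isCStarSeminorm : IsCStarSeminorm (fun a : WithMaxSeminorm B => ‖a‖) :=
  isCStarSeminorm_max (B := B)
variable (B)

instance : SeminormedAddCommGroup (WithMaxSeminorm B) :=
  SeminormedAddCommGroup.ofCore (𝕜 := ℂ)
    { norm_nonneg := norm_isCStarSeminorm.nonneg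
      norm_smul := norm_isCStarSeminorm.smul
      norm_triangle := norm_isCStarSeminorm.add_le }

instance : SeminormedRing (WithMaxSeminorm B) where
  __ := (inferInstance : SeminormedAddCommGroup (WithMaxSeminorm B))
  __ := (inferInstance : Ring (WithMaxSeminorm B))
  norm_mul_le := norm_isCStarSeminorm.mul_le

instance : NormedAlgebra ℂ (WithMaxSeminorm B) where
  norm_smul_le c a := (norm_isCStarSeminorm.smul c a).le

instance : NormedStarGroup (WithMaxSeminorm B) where
  norm_star_le a := (norm_isCStarSeminorm.star' a).le

end WithMaxSeminorm

/-- The enveloping C*-algebra of `B`: the (Hausdorff) completion in the largest C*-seminorm. -/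
def EnvelopingCStar : Type _ := UniformSpace.Completion (WithMaxSeminorm B)

namespace EnvelopingCStar
open UniformSpace

instance : NormedRing (EnvelopingCStar B) :=
  inferInstanceAs (NormedRing (Completion (WithMaxSeminorm B)))
instance : CompleteSpace (EnvelopingCStar B) :=
  inferInstanceAs (CompleteSpace (Completion (WithMaxSeminorm B)))
instance : Algebra ℂ (EnvelopingCStar B) :=
  inferInstanceAs (Algebra ℂ (Completion (WithMaxSeminorm B)))
instance : NormedAlgebra ℂ (EnvelopingCStar B) where
  norm_smul_le c a := norm_smul_le (β := Completion (WithMaxSeminorm B)) c a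

variable {B}
/-- The canonical map of `B` to its enveloping C*-algebra. -/
def of (b : B) : EnvelopingCStar B := ((show WithMaxSeminorm B from b : WithMaxSeminorm B) : Completion (WithMaxSeminorm B))

instance : Star (EnvelopingCStar B) :=
  ⟨Completion.map (star : WithMaxSeminorm B → WithMaxSeminorm B)⟩

theorem uc_star : UniformContinuous (star : WithMaxSeminorm B → WithMaxSeminorm B) :=
  (starNormedAddGroupHom (E := WithMaxSeminorm B)).uniformContinuous

theorem star_of (b : B) : star (of b) = of (star b) := Completion.map_coe uc_star _

theorem continuous_star' : Continuous (star : EnvelopingCStar B → EnvelopingCStar B) :=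
  Completion.continuous_map

theorem of_add (a b : B) : of (a + b) = of a + of b := Completion.coe_add _ _
theorem of_mul (a b : B) : of (a * b) = of a * of b := Completion.coe_mul _ _
theorem of_smul (c : ℂ) (b : B) : of (c • b) = c • of b := by
  have : UniformContinuousConstSMul ℂ (WithMaxSeminorm B) := inferInstance
  exact Completion.coe_smul (X := WithMaxSeminorm B) c b
theorem norm_of (b : B) : ‖of b‖ = maxCStarSeminorm B b :=
  Completion.norm_coe (E := WithMaxSeminorm B) b

theorem induction_of {p : EnvelopingCStar B → Prop} (a : EnvelopingCStar B)
    (hc : IsClosed {a | p a}) (h : ∀ b, p (of b)) : p a :=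
  Completion.induction_on (α := WithMaxSeminorm B) a hc h

theorem induction_of₂ {p : EnvelopingCStar B → EnvelopingCStar B → Prop} (a b : EnvelopingCStar B)
    (hc : IsClosed {x : EnvelopingCStar B × EnvelopingCStar B | p x.1 x.2})
    (h : ∀ a b, p (of a) (of b)) : p a b :=
  Completion.induction_on₂ (α := WithMaxSeminorm B) (β := WithMaxSeminorm B) a b hc h

instance [StarModule ℂ B] : CStarAlgebra (EnvelopingCStar B) where
  star_involutive a := by
    refine induction_of (p := fun a => star (star a) = a) a (isClosed_eq (continuous_star'.comp continuous_star') continuous_id) ?_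
    intro b; rw [star_of, star_of, star_star]
  star_mul a b := by
    refine induction_of₂ (p := fun a b => star (a * b) = star b * star a) a b
      (isClosed_eq ?_ ?_) ?_
    · exact continuous_star'.comp (continuous_fst.mul continuous_snd)
    · exact (continuous_star'.comp continuous_snd).mul (continuous_star'.comp continuous_fst)
    · intro a b; rw [← of_mul, star_of, star_mul, of_mul, star_of, star_of]
  star_add a b := by
    refine induction_of₂ (p := fun a b => star (a + b) = star a + star b) a b
      (isClosed_eq ?_ ?_) ?_
    · exact continuous_star'.comp (continuous_fst.add continuous_snd)
    · exact (continuous_star'.comp continuous_fst).add (continuous_star'.comp continuous_snd)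
    · intro a b; rw [← of_add, star_of, star_add, of_add, star_of, star_of]
  norm_mul_self_le a := by
    refine induction_of (p := fun a => ‖a‖ * ‖a‖ ≤ ‖star a * a‖) a (isClosed_le ?_ ?_) ?_
    · exact continuous_norm.mul continuous_norm
    · exact continuous_norm.comp (continuous_star'.mul continuous_id)
    · intro b
      rw [star_of, ← of_mul, norm_of, norm_of, isCStarSeminorm_max.star_mul_self, sq]
  star_smul c a := by
    refine induction_of (p := fun a => star (c • a) = star c • star a) a (isClosed_eq ?_ ?_) ?_
    · exact continuous_star'.comp (continuous_const_smul c)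
    · exact (continuous_star' (B := B)).const_smul (star c)
    · intro b; rw [← of_smul, star_of, star_smul, of_smul, star_of]
  norm_smul_le c a := norm_smul_le (β := Completion (WithMaxSeminorm B)) c a

end EnvelopingCStar
end Env

/-- The Weyl C*-algebra `Weyl(V, σ)`: the completion of `Δ(V, σ)` in its largest C*-norm, which is its
only C*-norm if `σ` is non-degenerate. -/
abbrev WeylAlgebra {V : Type*} [AddCommGroup V] [Module ℝ V] (σ : PresymplecticForm V) : Type _ :=
  EnvelopingCStar (WeylPre σ)

/-- The generator `W(v)` of the Weyl C*-algebra. -/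
def weylGen {V : Type*} [AddCommGroup V] [Module ℝ V] (σ : PresymplecticForm V) (v : V) :
    WeylAlgebra σ :=
  EnvelopingCStar.of (WeylPre.gen σ v)

/-- The tensor product of two unital C*-algebras: the completion of the algebraic tensor product in the
largest C*-norm, which is its only C*-norm if one factor is nuclear (as Weyl algebras are). -/
abbrev CStarTensor (A B : Type*) [CStarAlgebra A] [CStarAlgebra B] : Type _ :=
  EnvelopingCStar (A ⊗[ℂ] B)

/-- The elementary tensor `a ⊗ b`. -/
def cstarTmul {A B : Type*} [CStarAlgebra A] [CStarAlgebra B] (a : A) (b : B) : CStarTensor A B :=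
  EnvelopingCStar.of (a ⊗ₜ[ℂ] b)

end Weyl

section States

open scoped ComplexOrder

/-- States: continuous, positive, unital linear functionals. -/
structure IsState {A : Type*} [CStarAlgebra A] (φ : A →L[ℂ] ℂ) : Prop where
  map_one : φ 1 = 1
  nonneg : ∀ a, 0 ≤ φ (star a * a)

/-- Real inner products (symmetric, positive definite bilinear forms). -/
structure IsRealInnerProduct {V : Type*} [AddCommGroup V] [Module ℝ V]
    (μ : V →ₗ[ℝ] V →ₗ[ℝ] ℝ) : Prop where
  symm : ∀ v w, μ v w = μ w v
  pos : ∀ v, v ≠ 0 → 0 < μ v v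

variable {V₁ V₂ : Type*} [AddCommGroup V₁] [Module ℝ V₁] [AddCommGroup V₂] [Module ℝ V₂]

/-- `|σ₁(v₁, w₁) + σ₂(v₂, w₂)| ≤ 2 ‖v₁ ⊕ v₂‖_μ ‖w₁ ⊕ w₂‖_μ`. -/
def Dominates (μ : V₁ × V₂ →ₗ[ℝ] V₁ × V₂ →ₗ[ℝ] ℝ) (σ₁ : PresymplecticForm V₁)
    (σ₂ : PresymplecticForm V₂) : Prop :=
  ∀ v w : V₁ × V₂,
    |σ₁.form v.1 w.1 + σ₂.form v.2 w.2| ≤ 2 * √(μ v v) * √(μ w w)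

/-- `φ` is a quasi-free state on `Weyl(V₁, σ₁) ⊗ Weyl(V₂, σ₂)` with associated inner product `μ`. -/
structure IsQuasiFreeWith (σ₁ : PresymplecticForm V₁) (σ₂ : PresymplecticForm V₂)
    (μ : V₁ × V₂ →ₗ[ℝ] V₁ × V₂ →ₗ[ℝ] ℝ)
    (φ : CStarTensor (WeylAlgebra σ₁) (WeylAlgebra σ₂) →L[ℂ] ℂ) : Prop where
  isState : IsState φ
  isInner : IsRealInnerProduct μ
  dominates : Dominates μ σ₁ σ₂
  apply_gen : ∀ v : V₁ × V₂, φ (cstarTmul (weylGen σ₁ v.1) (weylGen σ₂ v.2)) =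
    Complex.exp (-(1 / 2) * (μ v v : ℂ))

/-- `K` is a one-particle structure for `(V₁ ⊕ V₂, σ₁ ⊕ σ₂)` and `μ`. -/
structure IsOneParticleStructure (σ₁ : PresymplecticForm V₁) (σ₂ : PresymplecticForm V₂)
    (μ : V₁ × V₂ →ₗ[ℝ] V₁ × V₂ →ₗ[ℝ] ℝ) {𝒦 : Type*} [NormedAddCommGroup 𝒦]
    [InnerProductSpace ℂ 𝒦] (K : V₁ × V₂ →ₗ[ℝ] 𝒦) : Prop where
  dense : Dense {x : 𝒦 | ∃ v w, x = K v + Complex.I • K w}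
  inner_eq : ∀ v w, inner ℂ (K v) (K w) =
    (μ v w : ℂ) + Complex.I / 2 * ((σ₁.form v.1 w.1 + σ₂.form v.2 w.2 : ℝ) : ℂ)

/-- `H` is the bosonic Fock space over `𝒦`, where `mon [ψ₁, …, ψₙ]` is the vector
`a*(ψ₁) ⋯ a*(ψₙ) Ω` and `mon []` is the vacuum `Ω`.  So the creation operators act by
`a*(ψ) mon l = mon (ψ :: l)`, and the annihilation operators, their adjoints, by
`a(ψ) mon [ψ₁, …, ψₙ] = ∑ⱼ ⟨ψ, ψⱼ⟩ mon [ψ₁, …, ψⱼ₋₁, ψⱼ₊₁, …, ψₙ]`; in particular `a(ψ) Ω = 0`.  These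
conditions determine all inner products of the vectors `mon l`, which are total. -/
structure IsFockSpace {𝒦 H : Type*} [NormedAddCommGroup 𝒦] [InnerProductSpace ℂ 𝒦]
    [NormedAddCommGroup H] [InnerProductSpace ℂ H] (mon : List 𝒦 → H) : Prop where
  norm_vacuum : ‖mon []‖ = 1
  inner_cons : ∀ (ψ : 𝒦) (l l' : List 𝒦), inner ℂ (mon (ψ :: l)) (mon l') =
    inner ℂ (mon l) (∑ j : Fin l'.length, inner ℂ ψ (l'.get j) • mon (l'.eraseIdx j))
  total : (Submodule.span ℂ (Set.range mon)).topologicalClosure = ⊤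

/-- The field operator `o(ψ) = a(ψ) + a*(ψ)` on the vector `mon l`. -/
def fieldOp {𝒦 H : Type*} [NormedAddCommGroup 𝒦] [InnerProductSpace ℂ 𝒦]
    [NormedAddCommGroup H] [InnerProductSpace ℂ H] (mon : List 𝒦 → H) (ψ : 𝒦) (l : List 𝒦) : H :=
  (∑ j : Fin l.length, inner ℂ ψ (l.get j) • mon (l.eraseIdx j)) + mon (ψ :: l)

/-- The GNS representation of the state `φ` on `Weyl(V₁, σ₁) ⊗ Weyl(V₂, σ₂)` is the bosonic Fock
representation of a one-particle structure `(𝒦, K)` of `μ`: there is a representation `π` on the Fock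
space `H` over `𝒦`, with the vacuum as cyclic vector that induces `φ`, such that
`π(W(v₁) ⊗ W(v₂)) = exp(i o(K(v₁ ⊕ v₂)))`.  The last condition says that the one-parameter unitary group
`t ↦ π(W(t v₁) ⊗ W(t v₂))` is generated by the field operator `o(K(v₁ ⊕ v₂))`, which is essentially
self-adjoint on the span of the vectors `mon l`. -/
def HasFockRepresentation.{u} {V₁ V₂ : Type u} [AddCommGroup V₁] [Module ℝ V₁] [AddCommGroup V₂]
    [Module ℝ V₂] (σ₁ : PresymplecticForm V₁) (σ₂ : PresymplecticForm V₂)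
    (μ : V₁ × V₂ →ₗ[ℝ] V₁ × V₂ →ₗ[ℝ] ℝ)
    (φ : CStarTensor (WeylAlgebra σ₁) (WeylAlgebra σ₂) →L[ℂ] ℂ) : Prop :=
  ∃ (𝒦 : Type u) (_ : NormedAddCommGroup 𝒦) (_ : InnerProductSpace ℂ 𝒦) (_ : CompleteSpace 𝒦)
    (H : Type u) (_ : NormedAddCommGroup H) (_ : InnerProductSpace ℂ H) (_ : CompleteSpace H)
    (K : V₁ × V₂ →ₗ[ℝ] 𝒦) (mon : List 𝒦 → H)
    (π : CStarTensor (WeylAlgebra σ₁) (WeylAlgebra σ₂) →⋆ₐ[ℂ] (H →L[ℂ] H)),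
    IsOneParticleStructure σ₁ σ₂ μ K ∧ IsFockSpace mon ∧
    (∀ a, inner ℂ (mon []) (π a (mon [])) = φ a) ∧
    Dense (Set.range fun a => π a (mon [])) ∧
    ∀ (v : V₁ × V₂) (l : List 𝒦),
      HasDerivAt (fun t : ℝ => π (cstarTmul (weylGen σ₁ (t • v.1)) (weylGen σ₂ (t • v.2))) (mon l))
        (Complex.I • fieldOp mon (K v) l) 0

end States

section Configurations

/-- The pre-symplectic form `(F₁ ⊕ H₁, F₂ ⊕ H₂) ↦ B(F₁, H₂) - B(F₂, H₁)` on `V ⊕ V`. -/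
def doubledForm {V : Type*} [AddCommGroup V] [Module ℝ V] (B : V →ₗ[ℝ] V →ₗ[ℝ] ℝ) :
    PresymplecticForm (V × V) where
  form := LinearMap.mk₂ ℝ (fun v w => B v.1 w.2 - B w.1 v.2)
    (fun v v' w => by simp only [Prod.fst_add, Prod.snd_add, map_add, LinearMap.add_apply]; ring)
    (fun c v w => by
      simp only [Prod.smul_fst, Prod.smul_snd, map_smul, LinearMap.smul_apply, smul_eq_mul]; ring)
    (fun v w w' => by simp only [Prod.fst_add, Prod.snd_add, map_add, LinearMap.add_apply]; ring)
    (fun c v w => by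
      simp only [Prod.smul_fst, Prod.smul_snd, map_smul, LinearMap.smul_apply, smul_eq_mul]; ring)
  alt v := by simp

/-- The bilinear form
`(F ⊕ H ⊕ f ⊕ h, F' ⊕ H' ⊕ f' ⊕ h') ↦ (B(F, F') + B(H, H') + b(f, f') + b(h, h')) / 2`. -/
def halfSumForm {V W : Type*} [AddCommGroup V] [Module ℝ V] [AddCommGroup W] [Module ℝ W]
    (B : V →ₗ[ℝ] V →ₗ[ℝ] ℝ) (b : W →ₗ[ℝ] W →ₗ[ℝ] ℝ) :
    (V × V) × (W × W) →ₗ[ℝ] (V × V) × (W × W) →ₗ[ℝ] ℝ :=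
  LinearMap.mk₂ ℝ
    (fun v w => 1 / 2 * (B v.1.1 w.1.1 + B v.1.2 w.1.2 + b v.2.1 w.2.1 + b v.2.2 w.2.2))
    (fun v v' w => by simp only [Prod.fst_add, Prod.snd_add, map_add, LinearMap.add_apply]; ring)
    (fun c v w => by
      simp only [Prod.smul_fst, Prod.smul_snd, map_smul, LinearMap.smul_apply, smul_eq_mul]; ring)
    (fun v w w' => by simp only [Prod.fst_add, Prod.snd_add, map_add, LinearMap.add_apply]; ring)
    (fun c v w => by
      simp only [Prod.smul_fst, Prod.smul_snd, map_smul, LinearMap.smul_apply, smul_eq_mul]; ring)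

variable {M : Type*} [TopologicalSpace M] [ChartedSpace (EuclideanHalfSpace 3) M]
  [IsManifold (𝓡∂ 3) ∞ M] [T2Space M] [CompactSpace M] [MeasurableSpace M] [BorelSpace M]

/-- The L² inner product on co-closed 1-forms with vanishing normal component. -/
def loopPairing (g : Metric3 M) :
    tangentialCoclosedForms g →ₗ[ℝ] tangentialCoclosedForms g →ₗ[ℝ] ℝ :=
  (formPairingBilin g).domRestrict₁₂ (tangentialCoclosedForms g) (tangentialCoclosedForms g)

/-- The symplectic form `σ^C` of the closed-loop configurations `V^C`, two copies of the space
`tangentialCoclosedForms g`. -/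
def sigmaC (g : Metric3 M) :
    PresymplecticForm (tangentialCoclosedForms g × tangentialCoclosedForms g) :=
  doubledForm (loopPairing g)

/-- The symplectic form `σ^S` of the surface configurations `V^S`, two copies of the space
`boundaryFluxes g`. -/
def sigmaS (g : Metric3 M) : PresymplecticForm (boundaryFluxes g × boundaryFluxes g) :=
  doubledForm (boundaryPairingBilin g)

/-- The form `μ_{L²}` on `V^C ⊕ V^S`. -/
def muL2 (g : Metric3 M) :
    (tangentialCoclosedForms g × tangentialCoclosedForms g) ×
      (boundaryFluxes g × boundaryFluxes g) →ₗ[ℝ]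
    (tangentialCoclosedForms g × tangentialCoclosedForms g) ×
      (boundaryFluxes g × boundaryFluxes g) →ₗ[ℝ] ℝ :=
  halfSumForm (loopPairing g) (boundaryPairingBilin g)

end Configurations

end L2Rep

end

/-!
The idea is to realise everything on the bosonic Fock space, and to handle that space through its
exponential (coherent) vectors instead of through symmetric tensors.

*Fock space.*  For a complex Hilbert space `𝒦` the kernel `exp ⟨φ, χ⟩` is positive semi-definite (Schur's
product theorem), so it is the Gram matrix of a total family of vectors `E χ` in a Hilbert space `H`, the
reproducing kernel Hilbert space (`exists_isExponential`).  The map `E` is continuous, and it is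
holomorphic along complex lines when tested against exponential vectors; by Cauchy's integral formula it
is holomorphic along complex lines (`differentiable_of_inner`).  The vectors `a*(ψ₁) ⋯ a*(ψₙ) Ω` are the
iterated derivatives of `E` at `0` (`creationVec`); differentiating the kernel yields the canonical
commutation relations, and Taylor's formula yields totality (`isFockSpace_creationVec`).

*Weyl operators.*  The formula `W(ψ) E χ = exp(-‖ψ‖²/2 + i⟨ψ, χ⟩) E (χ + iψ)` preserves the kernel, so it
defines operators on `H`, which satisfy the Weyl relations with the phase `exp(-i Im ⟨ψ, χ⟩)`.
Differentiating the formula in `χ` shows how `W(tψ)` acts on `a*(ψ₁) ⋯ a*(ψₙ) Ω`, and then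
differentiating in `t` identifies the generator with the field operator (`hasDerivAt_weylOp`).

*States.*  The pair of forms `μ`, `σ` comes from a complex inner product: the space `V ⊕ V` with its two
forms is the complexification of the real inner product space `V`, with `μ` as the real part and `σ / 2`
as the imaginary part of its inner product.  So the one-particle space is the completion of this
complexification, in which the image of `K` is dense, and the domination condition is the Cauchy–Schwarz
inequality.  The operators `W(K v)` represent the Weyl algebras and their tensor product by the universal
property of the enveloping C*-algebra; the vacuum expectation is the quasi-free state
(`exists_quasiFree_fock`), and the vacuum is cyclic because the exponential vectors are total.  The
state is unique because the products of the Weyl generators span a dense subspace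
(`clm_ext_weylGen`).

*Geometry.*  The only geometric input is that the L² pairings are positive definite, that is, that the
Riemannian volume and the area of the boundary charge every non-empty open set
(`chartMeasure_ne_zero`).
-/

noncomputable section

namespace L2Rep

/-! ### Exponential vectors -/

section ExponentialVectors

open scoped InnerProductSpace ComplexOrder

universe u

variable {𝒦 H : Type*} [NormedAddCommGroup 𝒦] [InnerProductSpace ℂ 𝒦]
  [NormedAddCommGroup H] [InnerProductSpace ℂ H]

/-- A total family of vectors `E ψ`, indexed by the vectors of the one-particle space, with the inner
products `⟨E φ, E χ⟩ = exp ⟨φ, χ⟩` of the coherent vectors `exp(a*(ψ)) Ω` of Fock space. -/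
structure IsExponential (E : 𝒦 → H) : Prop where
  inner_eq : ∀ φ χ, inner ℂ (E φ) (E χ) = Complex.exp (inner ℂ φ χ)
  total : (Submodule.span ℂ (Set.range E)).topologicalClosure = ⊤

theorem posSemidef_inner {ι : Type*} (v : ι → H) :
    (Matrix.of fun φ χ : ι => inner ℂ (v φ) (v χ)).PosSemidef := by
  refine ⟨?_, fun x => ?_⟩
  · ext φ χ
    simp
  · have h : (x.sum fun i xi => x.sum fun j xj => star xi * inner ℂ (v i) (v j) * xj) =
        inner ℂ (x.sum fun i xi => xi • v i) (x.sum fun i xi => xi • v i) := by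
      simp only [Finsupp.sum]
      rw [sum_inner]
      refine Finset.sum_congr rfl fun i _ => ?_
      rw [inner_sum]
      refine Finset.sum_congr rfl fun j _ => ?_
      rw [inner_smul_left, inner_smul_right, RCLike.star_def]
      ring
    refine le_of_le_of_eq ?_ h.symm
    rw [inner_self_eq_norm_sq_to_K]
    have h0 := Complex.zero_le_real.2 (sq_nonneg ‖x.sum fun i xi => xi • v i‖)
    rw [Complex.ofReal_pow] at h0
    exact h0

theorem posSemidef_inner_pow (n : ℕ) :
    (Matrix.of fun φ χ : 𝒦 => (inner ℂ φ χ) ^ n).PosSemidef := by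
  induction n with
  | zero => simpa using posSemidef_inner (fun _ : 𝒦 => (1 : ℂ))
  | succ n ih =>
    have h := ih.hadamard (posSemidef_inner (id : 𝒦 → 𝒦))
    simp only [pow_succ]
    exact h

/-- The kernel `exp ⟨φ, χ⟩` is positive semi-definite: it is a sum, with positive coefficients, of
Hadamard powers of a Gram matrix. -/
theorem posSemidef_exp_inner :
    (Matrix.of fun φ χ : 𝒦 => Complex.exp (inner ℂ φ χ)).PosSemidef := by
  refine ⟨?_, fun x => ?_⟩
  · ext φ χ
    simp only [Matrix.conjTranspose_apply, Matrix.of_apply, RCLike.star_def]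
    rw [← Complex.exp_conj, inner_conj_symm]
  · have hs : HasSum (fun n : ℕ => x.sum fun i xi => x.sum fun j xj =>
        star xi * (((n.factorial : ℂ))⁻¹ * (inner ℂ i j) ^ n) * xj)
        (x.sum fun i xi => x.sum fun j xj => star xi * Complex.exp (inner ℂ i j) * xj) := by
      refine hasSum_sum fun i _ => hasSum_sum fun j _ => ?_
      refine HasSum.mul_right _ (HasSum.mul_left _ ?_)
      have := NormedSpace.expSeries_div_hasSum_exp (𝔸 := ℂ) (inner ℂ i j)
      rw [← Complex.exp_eq_exp_ℂ] at this
      simpa [div_eq_inv_mul] using this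
    refine hs.nonneg fun n => ?_
    have h := (posSemidef_inner_pow (𝒦 := 𝒦) n).2 x
    have h0 : (0 : ℂ) ≤ ((n.factorial : ℂ))⁻¹ := by
      rw [← Complex.ofReal_natCast, ← Complex.ofReal_inv, Complex.zero_le_real]
      positivity
    have h1 := mul_nonneg h0 h
    refine h1.trans_eq ?_
    simp only [Finsupp.mul_sum, Matrix.of_apply]
    refine Finsupp.sum_congr fun i _ => Finsupp.sum_congr fun j _ => ?_
    ring

/-- The exponential kernel as an operator-valued kernel. -/
def expKernel (𝒦 : Type*) [NormedAddCommGroup 𝒦] [InnerProductSpace ℂ 𝒦] :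
    Matrix 𝒦 𝒦 (ℂ →L[ℂ] ℂ) :=
  Matrix.of fun φ χ => Complex.exp (inner ℂ φ χ) • ContinuousLinearMap.id ℂ ℂ

theorem posSemidef_expKernel : (expKernel 𝒦).PosSemidef := by
  have htfae := (RKHS.posSemidef_tfae (K := expKernel 𝒦)).out 0 2
  refine htfae.2 ⟨?_, fun x => ?_⟩
  · ext φ χ
    simp only [Matrix.conjTranspose_apply, expKernel, Matrix.of_apply, star_smul]
    rw [RCLike.star_def, ← Complex.exp_conj, inner_conj_symm]
    exact congrArg (fun T : ℂ →L[ℂ] ℂ => (Complex.exp (inner ℂ φ χ) • T) 1) (star_one (ℂ →L[ℂ] ℂ))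
  · have h := (Complex.nonneg_iff.1 ((posSemidef_exp_inner (𝒦 := 𝒦)).2 x)).1
    refine h.trans_eq ?_
    congr 1
    refine Finsupp.sum_congr fun i _ => Finsupp.sum_congr fun j _ => ?_
    simp only [Matrix.of_apply, expKernel, smul_apply, ContinuousLinearMap.id_apply, smul_eq_mul,
      RCLike.inner_apply, map_mul, ← Complex.exp_conj, inner_conj_symm, RCLike.star_def]
    ring

/-- Exponential vectors exist: they are the kernel functions of the reproducing kernel Hilbert space
of the kernel `exp ⟨φ, χ⟩`. -/
theorem exists_isExponential (𝒦 : Type u) [NormedAddCommGroup 𝒦] [InnerProductSpace ℂ 𝒦] :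
    ∃ (H : Type u) (_ : NormedAddCommGroup H) (_ : InnerProductSpace ℂ H) (_ : CompleteSpace H)
      (E : 𝒦 → H), IsExponential E := by
  have : Fact (expKernel 𝒦).PosSemidef := ⟨posSemidef_expKernel⟩
  refine ⟨RKHS.OfKernel (expKernel 𝒦), inferInstance, inferInstance, inferInstance,
    fun χ => RKHS.kerFun (RKHS.OfKernel (expKernel 𝒦)) χ 1, fun φ χ => ?_, ?_⟩
  · rw [← RKHS.kernel_inner, RKHS.OfKernel.kernel_ofKernel]
    simp [expKernel, ← Complex.exp_conj, inner_conj_symm]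
  · rw [eq_top_iff, ← RKHS.kerFun_dense (RKHS.OfKernel (expKernel 𝒦))]
    refine Submodule.topologicalClosure_mono (Submodule.span_le.2 ?_)
    rintro _ ⟨χ, z, rfl⟩
    have : RKHS.kerFun (RKHS.OfKernel (expKernel 𝒦)) χ z =
        z • RKHS.kerFun (RKHS.OfKernel (expKernel 𝒦)) χ 1 := by
      rw [← map_smul, smul_eq_mul, mul_one]
    rw [this]
    exact Submodule.smul_mem _ _ (Submodule.subset_span ⟨χ, rfl⟩)

end ExponentialVectors

/-! ### Weak and strong holomorphy -/

section WeakHolomorphy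

variable {H : Type*} [NormedAddCommGroup H] [InnerProductSpace ℂ H]

theorem eq_of_total {S : Set H} (hS : (Submodule.span ℂ S).topologicalClosure = ⊤) {a b : H}
    (h : ∀ x ∈ S, inner ℂ x a = inner ℂ x b) : a = b := by
  refine Dense.eq_of_inner_right ℂ ((Submodule.dense_iff_topologicalClosure_eq_top).2 hS)
    fun v hv => ?_
  induction hv using Submodule.span_induction with
  | mem x hx => exact h x hx
  | zero => simp
  | add x y _ _ hx hy => rw [inner_add_left, inner_add_left, hx, hy]
  | smul c x _ hx => rw [inner_smul_left, inner_smul_left, hx]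

theorem clm_ext_of_total {S : Set H} (hS : (Submodule.span ℂ S).topologicalClosure = ⊤)
    {T T' : H →L[ℂ] H} (h : ∀ x ∈ S, T x = T' x) : T = T' :=
  ContinuousLinearMap.ext_on ((Submodule.dense_iff_topologicalClosure_eq_top).2 hS) h

variable [CompleteSpace H]

theorem inner_circleIntegral {g : ℂ → H} {c : ℂ} {R : ℝ} (hg : CircleIntegrable g c R) (x : H) :
    inner ℂ x (∮ z in C(c, R), g z) = ∮ z in C(c, R), inner ℂ x (g z) := by
  have h := (innerSL ℂ x).intervalIntegral_comp_comm hg.out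
  simp only [innerSL_apply_apply] at h
  unfold circleIntegral
  rw [← h]
  simp only [inner_smul_right, smul_eq_mul]

/-- A continuous function into a Hilbert space that is holomorphic when tested against a total set is
holomorphic: it satisfies Cauchy's integral formula, because it does so after testing. -/
theorem differentiable_of_inner {S : Set H} (hS : (Submodule.span ℂ S).topologicalClosure = ⊤)
    {f : ℂ → H} (hf : Continuous f)
    (hw : ∀ x ∈ S, Differentiable ℂ fun s => inner ℂ x (f s)) : Differentiable ℂ f := by
  intro c
  have hc : CircleIntegrable f c (1 : NNReal) :=
    hf.continuousOn.circleIntegrable (NNReal.coe_nonneg _)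
  have hp := hasFPowerSeriesOn_cauchy_integral hc one_pos
  have key : ∀ w ∈ Metric.ball c 1,
      (2 * Real.pi * Complex.I : ℂ)⁻¹ • (∮ z in C(c, (1 : NNReal)), (z - w)⁻¹ • f z) = f w := by
    intro w hwb
    refine eq_of_total hS fun x hx => ?_
    have hi : CircleIntegrable (fun z => (z - w)⁻¹ • f z) c (1 : NNReal) := by
      refine ContinuousOn.circleIntegrable (NNReal.coe_nonneg _) (ContinuousOn.smul ?_
        hf.continuousOn)
      refine (continuous_id.sub continuous_const).continuousOn.inv₀ fun z hz h => ?_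
      refine Metric.sphere_disjoint_ball.ne_of_mem hz ?_ (sub_eq_zero.1 h)
      simpa using hwb
    rw [inner_smul_right, inner_circleIntegral hi]
    simp only [inner_smul_right]
    have hdc := (hw x hx).diffContOnCl (s := Metric.ball c 1)
    have h := hdc.two_pi_i_inv_smul_circleIntegral_sub_inv_smul hwb
    simpa using h
  have hd : DifferentiableAt ℂ (fun w => (2 * Real.pi * Complex.I : ℂ)⁻¹ •
      ∮ z in C(c, (1 : NNReal)), (z - w)⁻¹ • f z) c :=
    (hp.analyticAt).differentiableAt
  refine hd.congr_of_eventuallyEq ?_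
  filter_upwards [Metric.ball_mem_nhds c one_pos] with w hw'
  exact (key w hw').symm

end WeakHolomorphy

/-! ### Creation operators and the Fock space -/

section CreationVectors

variable {𝒦 H : Type*} [NormedAddCommGroup 𝒦] [InnerProductSpace ℂ 𝒦]
  [NormedAddCommGroup H] [InnerProductSpace ℂ H]

/-- The vector `a*(ψ₁) ⋯ a*(ψₙ) E χ`, for `l = [ψ₁, …, ψₙ]`: the iterated derivative of the map `E` at
`χ` in the directions `ψ₁, …, ψₙ`. -/
def creationVec (E : 𝒦 → H) : List 𝒦 → 𝒦 → H
  | [], χ => E χ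
  | ψ :: l, χ => deriv (fun s : ℂ => creationVec E l (χ + s • ψ)) 0

variable {E : 𝒦 → H}

theorem IsExponential.continuous (hE : IsExponential E) : Continuous E := by
  rw [continuous_iff_continuousAt]
  intro χ
  rw [ContinuousAt, tendsto_iff_norm_sub_tendsto_zero]
  have h : ∀ φ, ‖E φ - E χ‖ = √(RCLike.re (Complex.exp (inner ℂ φ φ) - Complex.exp (inner ℂ φ χ)
      - Complex.exp (inner ℂ χ φ) + Complex.exp (inner ℂ χ χ)) : ℝ) := by
    intro φ
    rw [norm_eq_sqrt_re_inner (𝕜 := ℂ), inner_sub_left, inner_sub_right, inner_sub_right,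
      hE.inner_eq, hE.inner_eq, hE.inner_eq, hE.inner_eq]
    congr 2
    ring
  simp only [h]
  have hc : Continuous fun φ : 𝒦 => √(RCLike.re (Complex.exp (inner ℂ φ φ) -
      Complex.exp (inner ℂ φ χ) - Complex.exp (inner ℂ χ φ) + Complex.exp (inner ℂ χ χ)) : ℝ) := by
    fun_prop
  simpa using hc.tendsto χ

variable [CompleteSpace H]

/-- The vectors `creationVec E l χ` depend continuously on `χ`, and holomorphically along complex
lines, and their inner products with exponential vectors are as expected. -/
theorem creationVec_spec (hE : IsExponential E) (l : List 𝒦) :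
    Continuous (creationVec E l) ∧
    (∀ χ ψ, Differentiable ℂ fun s : ℂ => creationVec E l (χ + s • ψ)) ∧
    ∀ φ χ, inner ℂ (E φ) (creationVec E l χ) =
      Complex.exp (inner ℂ φ χ) * (l.map fun ψ => inner ℂ φ ψ).prod := by
  -- The first and the third property of a list imply the second one.
  have step : ∀ l : List 𝒦, Continuous (creationVec E l) →
      (∀ φ χ, inner ℂ (E φ) (creationVec E l χ) =
        Complex.exp (inner ℂ φ χ) * (l.map fun ψ => inner ℂ φ ψ).prod) →
      ∀ χ ψ, Differentiable ℂ fun s : ℂ => creationVec E l (χ + s • ψ) := by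
    intro l hc hi χ ψ
    refine differentiable_of_inner hE.total (hc.comp (by fun_prop)) ?_
    rintro _ ⟨φ, rfl⟩
    simp only [hi, inner_add_right, inner_smul_right]
    fun_prop
  induction l with
  | nil =>
    have hi : ∀ φ χ, inner ℂ (E φ) (creationVec E [] χ) =
        Complex.exp (inner ℂ φ χ) * (([] : List 𝒦).map fun ψ => inner ℂ φ ψ).prod := fun φ χ => by
      simp [creationVec, hE.inner_eq]
    exact ⟨hE.continuous, step _ hE.continuous hi, hi⟩
  | cons ψ l ih =>
    obtain ⟨hc, hd, hi⟩ := ih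
    -- Cauchy's formula for the derivative is an integral that depends continuously on `χ`.
    have hc' : Continuous (creationVec E (ψ :: l)) := by
      have h : creationVec E (ψ :: l) = fun χ => (2 * Real.pi * Complex.I : ℂ)⁻¹ •
          ∮ z in C(0, 1), ((z - 0) ^ 2)⁻¹ • creationVec E l (χ + z • ψ) := by
        ext χ
        rw [Complex.two_pi_I_inv_smul_circleIntegral_sub_sq_inv_smul_of_differentiable isOpen_univ
          (Set.subset_univ _) (hd χ ψ).differentiableOn (Metric.mem_ball_self one_pos)]
        rfl
      rw [h]
      refine Continuous.const_smul ?_ _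
      unfold circleIntegral
      refine intervalIntegral.continuous_parametric_intervalIntegral_of_continuous' ?_ _ _
      have h0 : ∀ p : 𝒦 × ℝ, (circleMap 0 1 p.2 - 0) ^ 2 ≠ 0 := fun p => by
        rw [sub_zero]
        exact pow_ne_zero _ (circleMap_ne_center one_ne_zero)
      have h1 : Continuous fun p : 𝒦 × ℝ => circleMap 0 1 p.2 := by fun_prop
      simp only [Function.uncurry_def, deriv_circleMap]
      exact (h1.mul continuous_const).smul ((((h1.sub continuous_const).pow 2).inv₀ h0).smul
        (hc.comp (continuous_fst.add (h1.smul continuous_const))))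
    have hi' : ∀ φ χ, inner ℂ (E φ) (creationVec E (ψ :: l) χ) =
        Complex.exp (inner ℂ φ χ) * ((ψ :: l).map fun ψ => inner ℂ φ ψ).prod := by
      intro φ χ
      have h1 := (innerSL ℂ (E φ)).hasFDerivAt.comp_hasDerivAt (0 : ℂ) ((hd χ ψ) 0).hasDerivAt
      have h2 : HasDerivAt (fun s : ℂ => Complex.exp (inner ℂ φ χ + s * inner ℂ φ ψ) *
          (l.map fun ψ => inner ℂ φ ψ).prod)
          (Complex.exp (inner ℂ φ χ + 0 * inner ℂ φ ψ) * (1 * inner ℂ φ ψ) *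
            (l.map fun ψ => inner ℂ φ ψ).prod) 0 :=
        ((((hasDerivAt_id (0 : ℂ)).mul_const _).const_add _).cexp).mul_const _
      have h3 : (innerSL ℂ (E φ) ∘ fun s : ℂ => creationVec E l (χ + s • ψ)) =
          fun s : ℂ => Complex.exp (inner ℂ φ χ + s * inner ℂ φ ψ) *
            (l.map fun ψ => inner ℂ φ ψ).prod := by
        ext s
        simp [hi]
      rw [h3] at h1
      have h4 := h1.unique h2
      simp only [innerSL_apply_apply] at h4
      change inner ℂ (E φ) (deriv (fun s : ℂ => creationVec E l (χ + s • ψ)) 0) = _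
      rw [h4]
      simp [mul_assoc]
    exact ⟨hc', step _ hc' hi', hi'⟩

theorem hasDerivAt_creationVec (hE : IsExponential E) (l : List 𝒦) (χ ψ : 𝒦) (s : ℂ) :
    HasDerivAt (fun s : ℂ => creationVec E l (χ + s • ψ)) (creationVec E (ψ :: l) (χ + s • ψ)) s := by
  have h := ((creationVec_spec hE l).2.1 (χ + s • ψ) ψ 0).hasDerivAt
  have h2 : HasDerivAt (fun s' : ℂ => s' - s) 1 s := (hasDerivAt_id s).sub_const s
  rw [← sub_self s] at h
  have h3 := HasDerivAt.scomp (h := fun s' : ℂ => s' - s) s h h2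
  simp only [one_smul, sub_self] at h3
  refine h3.congr_of_eventuallyEq (Filter.Eventually.of_forall fun s' => ?_)
  simp only [Function.comp_apply]
  congr 1
  module

/-- The sum `∑ⱼ ⟨ψ, ψⱼ⟩ F [ψ₁, …, ψⱼ₋₁, ψⱼ₊₁, …, ψₙ]` of the annihilation operator. -/
def annihSum (ψ : 𝒦) (F : List 𝒦 → H) (l : List 𝒦) : H :=
  ∑ j : Fin l.length, inner ℂ ψ (l.get j) • F (l.eraseIdx j)

omit [CompleteSpace H] in
theorem annihSum_cons (ψ φ : 𝒦) (F : List 𝒦 → H) (l : List 𝒦) :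
    annihSum ψ F (φ :: l) = inner ℂ ψ φ • F l + annihSum ψ (fun m => F (φ :: m)) l := by
  exact Fin.sum_univ_succ (n := l.length)
    fun j => inner ℂ ψ ((φ :: l).get j) • F ((φ :: l).eraseIdx j)

theorem hasDerivAt_annihSum (hE : IsExponential E) (ψ φ χ : 𝒦) (l : List 𝒦) :
    HasDerivAt (fun s : ℂ => annihSum ψ (fun m => creationVec E m (χ + s • φ)) l)
      (annihSum ψ (fun m => creationVec E (φ :: m) χ) l) 0 := by
  unfold annihSum
  refine HasDerivAt.fun_sum fun j _ => ?_
  have := hasDerivAt_creationVec hE (l.eraseIdx j) χ φ 0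
  rw [zero_smul, add_zero] at this
  exact this.const_smul _

/-- The canonical commutation relation, in the form that the adjoint of `a*(ψ)` acts on
`creationVec E l' χ'` as `a(ψ)`. -/
theorem inner_creationVec_cons (hE : IsExponential E) (ψ χ : 𝒦) (l l' : List 𝒦) (χ' : 𝒦) :
    inner ℂ (creationVec E (ψ :: l) χ) (creationVec E l' χ') =
      inner ℂ (creationVec E l χ) (inner ℂ ψ χ' • creationVec E l' χ' +
        annihSum ψ (fun m => creationVec E m χ') l') := by
  induction l' generalizing χ' with
  | nil =>
    have h : ∀ l, inner ℂ (creationVec E l χ) (E χ') = starRingEnd ℂ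
        (Complex.exp (inner ℂ χ' χ) * (l.map fun ψ => inner ℂ χ' ψ).prod) := fun l => by
      rw [← (creationVec_spec hE l).2.2, inner_conj_symm]
    simp only [creationVec, annihSum, List.length_nil, Finset.univ_eq_empty, Finset.sum_empty,
      add_zero, inner_smul_right, h]
    rw [← inner_conj_symm ψ χ', ← map_mul]
    have := h (ψ :: l)
    simp only [creationVec] at this
    rw [this]
    congr 1
    simp only [List.map_cons, List.prod_cons]
    ring
  | cons φ l' ih =>
    have h1 := hasDerivAt_creationVec hE l' χ' φ 0
    rw [zero_smul, add_zero] at h1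
    have h2 := (innerSL ℂ (creationVec E (ψ :: l) χ)).hasFDerivAt.comp_hasDerivAt (0 : ℂ) h1
    have h3 : HasDerivAt (fun s : ℂ => inner ℂ ψ (χ' + s • φ)) (inner ℂ ψ φ) 0 := by
      simp only [inner_add_right, inner_smul_right]
      simpa using ((hasDerivAt_id (0 : ℂ)).mul_const (inner ℂ ψ φ)).const_add (inner ℂ ψ χ')
    have h4 := (h3.smul h1).add (hasDerivAt_annihSum hE ψ φ χ' l')
    have h5 := (innerSL ℂ (creationVec E l χ)).hasFDerivAt.comp_hasDerivAt (0 : ℂ) h4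
    have h6 := h2.unique (h5.congr_of_eventuallyEq (Filter.Eventually.of_forall fun s => by
      exact ih (χ' + s • φ)))
    simp only [innerSL_apply_apply, zero_smul, add_zero] at h6
    rw [h6, annihSum_cons]
    congr 1
    abel

/-- The vectors `a*(ψ₁) ⋯ a*(ψₙ) Ω` form the Fock space: by Taylor's formula their closed span contains
the exponential vectors. -/
theorem isFockSpace_creationVec (hE : IsExponential E) :
    IsFockSpace fun l => creationVec E l 0 where
  norm_vacuum := by
    have h := hE.inner_eq 0 0
    rw [inner_self_eq_norm_sq_to_K, inner_zero_left, Complex.exp_zero] at h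
    have h2 : ‖E 0‖ ^ 2 = 1 := Complex.ofReal_injective (by rw [Complex.ofReal_pow]; exact h)
    exact (pow_eq_one_iff_of_nonneg (norm_nonneg _) two_ne_zero).1 h2
  inner_cons ψ l l' := by
    rw [inner_creationVec_cons hE, inner_zero_right, zero_smul, zero_add]
    rfl
  total := by
    rw [Submodule.topologicalClosure_eq_top_iff, Submodule.eq_bot_iff]
    intro x hx
    have h0 : ∀ l, inner ℂ x (creationVec E l 0) = 0 := fun l => by
      rw [← inner_conj_symm, hx _ (Submodule.subset_span ⟨l, rfl⟩), map_zero]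
    refine eq_of_total hE.total ?_
    rintro _ ⟨χ, rfl⟩
    rw [inner_zero_right, ← inner_conj_symm, map_eq_zero]
    -- The Taylor coefficients of `s ↦ ⟨x, E (sχ)⟩` are inner products of `x` with creation vectors.
    have hder : ∀ n, iteratedDeriv n (fun s : ℂ => inner ℂ x (E (s • χ))) =
        fun s : ℂ => inner ℂ x (creationVec E (List.replicate n χ) (s • χ)) := by
      intro n
      induction n with
      | zero => simp [creationVec]
      | succ n ih =>
        ext s
        rw [iteratedDeriv_succ, ih]
        have h := hasDerivAt_creationVec hE (List.replicate n χ) 0 χ s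
        simp only [zero_add] at h
        exact ((innerSL ℂ x).hasFDerivAt.comp_hasDerivAt s h).deriv
    have hd : Differentiable ℂ fun s : ℂ => inner ℂ x (E (s • χ)) := fun s => by
      have h := hasDerivAt_creationVec hE [] 0 χ s
      simp only [zero_add] at h
      exact ((innerSL ℂ x).hasFDerivAt.comp_hasDerivAt s h).differentiableAt
    have ht := Complex.taylorSeries_eq_of_entire hd 0 1
    simp only [hder, zero_smul, h0, smul_zero, tsum_zero, one_smul] at ht
    exact ht.symm

end CreationVectors

/-! ### Weyl operators -/

section WeylOperators

variable {𝒦 H : Type*} [NormedAddCommGroup 𝒦] [InnerProductSpace ℂ 𝒦]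
  [NormedAddCommGroup H] [InnerProductSpace ℂ H] [CompleteSpace H]

/-- A map of a total family of vectors that preserves inner products extends to a bounded operator. -/
theorem exists_clm_of_inner_eq {ι : Type*} {E E' : ι → H}
    (hE : (Submodule.span ℂ (Set.range E)).topologicalClosure = ⊤)
    (h : ∀ i j, inner ℂ (E' i) (E' j) = inner ℂ (E i) (E j)) :
    ∃ T : H →L[ℂ] H, ∀ i, T (E i) = E' i := by
  have hd : DenseRange (Finsupp.linearCombination ℂ E) := by
    have h1 := (Submodule.dense_iff_topologicalClosure_eq_top).2 hE
    rw [← Finsupp.range_linearCombination] at h1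
    exact h1
  have key : ∀ F : ι → H, ∀ x : ι →₀ ℂ, ‖Finsupp.linearCombination ℂ F x‖ =
      √(RCLike.re (∑ i ∈ x.support, ∑ j ∈ x.support,
        starRingEnd ℂ (x i) * (x j * inner ℂ (F i) (F j))) : ℝ) := by
    intro F x
    rw [norm_eq_sqrt_re_inner (𝕜 := ℂ), Finsupp.linearCombination_apply, Finsupp.sum]
    congr 2
    rw [sum_inner]
    refine Finset.sum_congr rfl fun i _ => ?_
    rw [inner_sum]
    refine Finset.sum_congr rfl fun j _ => ?_
    rw [inner_smul_left, inner_smul_right]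
  have hn : ∀ x, ‖Finsupp.linearCombination ℂ E' x‖ = ‖Finsupp.linearCombination ℂ E x‖ := by
    intro x
    simp only [key, h]
  refine ⟨(Finsupp.linearCombination ℂ E').extendOfNorm (Finsupp.linearCombination ℂ E),
    fun i => ?_⟩
  have h2 := LinearMap.extendOfNorm_eq (f := Finsupp.linearCombination ℂ E') hd
    ⟨1, fun x => by rw [one_mul, hn]⟩ (Finsupp.single i 1)
  simpa using h2

/-- The factor in `W(ψ) E χ = exp(-‖ψ‖²/2 + i⟨ψ, χ⟩) E (χ + iψ)`. -/
def weylFactor (ψ χ : 𝒦) : ℂ :=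
  Complex.exp (-(inner ℂ ψ ψ) / 2 + Complex.I * inner ℂ ψ χ)

variable {E : 𝒦 → H}

theorem exists_weylOp (hE : IsExponential E) (ψ : 𝒦) :
    ∃ T : H →L[ℂ] H, ∀ χ, T (E χ) = weylFactor ψ χ • E (χ + Complex.I • ψ) := by
  refine exists_clm_of_inner_eq hE.total fun φ χ => ?_
  rw [inner_smul_left, inner_smul_right, hE.inner_eq, hE.inner_eq]
  unfold weylFactor
  rw [← Complex.exp_conj, ← Complex.exp_add, ← Complex.exp_add]
  congr 1
  simp only [map_add, map_neg, map_mul, map_div₀, inner_conj_symm, Complex.conj_I, inner_add_left,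
    inner_add_right, inner_smul_left, inner_smul_right, Complex.conj_ofNat]
  linear_combination (-inner ℂ ψ ψ) * Complex.I_sq

/-- The Weyl operator `W(ψ) = exp(i(a(ψ) + a*(ψ)))`. -/
def weylOp (hE : IsExponential E) (ψ : 𝒦) : H →L[ℂ] H := (exists_weylOp hE ψ).choose

theorem weylOp_apply (hE : IsExponential E) (ψ χ : 𝒦) :
    weylOp hE ψ (E χ) = weylFactor ψ χ • E (χ + Complex.I • ψ) :=
  (exists_weylOp hE ψ).choose_spec χ

theorem weylOp_mul (hE : IsExponential E) (ψ χ : 𝒦) :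
    weylOp hE ψ * weylOp hE χ =
      Complex.exp (-Complex.I * ((inner ℂ ψ χ).im : ℂ)) • weylOp hE (ψ + χ) := by
  refine clm_ext_of_total hE.total ?_
  rintro _ ⟨φ, rfl⟩
  rw [mul_apply_eq_comp, weylOp_apply, map_smul, weylOp_apply, smul_apply,
    weylOp_apply, smul_smul, smul_smul]
  congr 1
  · unfold weylFactor
    rw [← Complex.exp_add, ← Complex.exp_add]
    congr 1
    have h : (inner ℂ χ ψ : ℂ) = inner ℂ ψ χ - 2 * ((inner ℂ ψ χ).im : ℂ) * Complex.I := by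
      rw [← inner_conj_symm χ ψ]
      generalize (inner ℂ ψ χ : ℂ) = z
      apply Complex.ext
      · simp
      · simp
        ring
    simp only [inner_add_left, inner_add_right, inner_smul_right]
    rw [h]
    linear_combination (inner ℂ ψ χ) * Complex.I_sq
  · congr 1
    rw [smul_add]
    abel

theorem weylOp_zero (hE : IsExponential E) : weylOp hE 0 = 1 := by
  refine clm_ext_of_total hE.total ?_
  rintro _ ⟨φ, rfl⟩
  simp [weylOp_apply, weylFactor]

theorem star_weylOp (hE : IsExponential E) (ψ : 𝒦) : star (weylOp hE ψ) = weylOp hE (-ψ) := by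
  refine clm_ext_of_total hE.total ?_
  rintro _ ⟨χ, rfl⟩
  refine eq_of_total hE.total ?_
  rintro _ ⟨φ, rfl⟩
  rw [ContinuousLinearMap.star_eq_adjoint, ContinuousLinearMap.adjoint_inner_right, weylOp_apply,
    weylOp_apply, inner_smul_left, inner_smul_right, hE.inner_eq, hE.inner_eq]
  unfold weylFactor
  rw [← Complex.exp_conj, ← Complex.exp_add, ← Complex.exp_add]
  congr 1
  simp only [map_add, map_neg, map_mul, map_div₀, inner_conj_symm, Complex.conj_I, inner_add_left,
    inner_add_right, inner_smul_left, inner_smul_right, Complex.conj_ofNat, inner_neg_left,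
    inner_neg_right, smul_neg, neg_neg]
  ring

theorem inner_weylOp_vacuum (hE : IsExponential E) (ψ : 𝒦) :
    inner ℂ (E 0) (weylOp hE ψ (E 0)) = Complex.exp (-(1 / 2) * inner ℂ ψ ψ) := by
  rw [weylOp_apply, inner_smul_right, hE.inner_eq, weylFactor]
  simp only [inner_zero_left, inner_zero_right, Complex.exp_zero]
  ring_nf

/-- The vector `a*(m) (a*(φ₁) + it⟨ψ, φ₁⟩) ⋯ (a*(φₙ) + it⟨ψ, φₙ⟩) E χ` for `l = [φ₁, …, φₙ]`, where `a*(m)`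
is the product of the creation operators of the list `m`. -/
def shiftedVec (E : 𝒦 → H) (ψ : 𝒦) : List 𝒦 → List 𝒦 → ℂ → 𝒦 → H
  | m, [], _, χ => creationVec E m χ
  | m, φ :: l, t, χ => shiftedVec E ψ (m ++ [φ]) l t χ +
      (Complex.I * t * inner ℂ ψ φ) • shiftedVec E ψ m l t χ

omit [CompleteSpace H] in
theorem shiftedVec_zero (ψ χ : 𝒦) (l m : List 𝒦) :
    shiftedVec E ψ m l 0 χ = creationVec E (m ++ l) χ := by
  induction l generalizing m with
  | nil => simp [shiftedVec]
  | cons φ l ih => simp [shiftedVec, ih]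

theorem hasDerivAt_shiftedVec (hE : IsExponential E) (ψ χ φ : 𝒦) (t : ℂ) (l m : List 𝒦) :
    HasDerivAt (fun s : ℂ => shiftedVec E ψ m l t (χ + s • φ)) (shiftedVec E ψ (φ :: m) l t χ) 0 := by
  induction l generalizing m with
  | nil =>
    have := hasDerivAt_creationVec hE m χ φ 0
    rw [zero_smul, add_zero] at this
    exact this
  | cons φ' l ih => exact (ih (m ++ [φ'])).add ((ih m).const_smul _)

/-- `W(tψ) a*(φ) W(tψ)⁻¹ = a*(φ) + it⟨ψ, φ⟩`, applied to the product of several creation operators. -/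
theorem weylOp_creationVec (hE : IsExponential E) (ψ : 𝒦) (t : ℝ) (l : List 𝒦) (χ : 𝒦) :
    weylOp hE (t • ψ) (creationVec E l χ) =
      weylFactor (t • ψ) χ • shiftedVec E ψ [] l t (χ + Complex.I • t • ψ) := by
  induction l generalizing χ with
  | nil => exact weylOp_apply hE _ _
  | cons φ l ih =>
    have h1 := hasDerivAt_creationVec hE l χ φ 0
    rw [zero_smul, add_zero] at h1
    have h2 := (weylOp hE (t • ψ)).hasFDerivAt.comp_hasDerivAt (0 : ℂ) h1
    have h3 := hasDerivAt_shiftedVec hE ψ (χ + Complex.I • t • ψ) φ t l []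
    have h4 : HasDerivAt (fun s : ℂ => weylFactor (t • ψ) (χ + s • φ))
        (weylFactor (t • ψ) χ * (Complex.I * inner ℂ (t • ψ) φ)) 0 := by
      unfold weylFactor
      simp only [inner_add_right, inner_smul_right]
      have := ((((((hasDerivAt_id (0 : ℂ)).mul_const (inner ℂ (t • ψ) φ)).const_add
        (inner ℂ (t • ψ) χ)).const_mul Complex.I).const_add (-(inner ℂ (t • ψ) (t • ψ)) / 2))).cexp
      refine this.congr_deriv ?_
      simp only [id_eq, zero_mul, add_zero, one_mul]
    have h5 := h4.smul h3
    have h6 := h2.unique (h5.congr_of_eventuallyEq (Filter.Eventually.of_forall fun s => by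
      simp only [Function.comp_apply, ih]
      congr 2
      abel))
    simp only [zero_smul, add_zero] at h6
    rw [h6]
    simp only [shiftedVec, List.nil_append, smul_add, smul_smul]
    congr 2
    rw [← Complex.coe_smul, inner_smul_left, Complex.conj_ofReal]
    ring

/-- The derivative at `t = 0` of the product of the operators `a*(φⱼ) + it⟨ψ, φⱼ⟩`, applied to `E (itψ)`:
the factors contribute the annihilation operator, the exponential vector the creation operator. -/
theorem hasDerivAt_shiftedVec_param (hE : IsExponential E) (ψ : 𝒦) (l m : List 𝒦) :
    HasDerivAt (fun t : ℂ => shiftedVec E ψ m l t (t • Complex.I • ψ))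
      (Complex.I • (annihSum ψ (fun m' => creationVec E (m ++ m') 0) l +
        creationVec E (ψ :: (m ++ l)) 0)) 0 := by
  induction l generalizing m with
  | nil =>
    have h := hasDerivAt_creationVec hE m 0 ψ 0
    have h2 : HasDerivAt (fun t : ℂ => t * Complex.I) Complex.I 0 := by
      simpa using (hasDerivAt_id (0 : ℂ)).mul_const Complex.I
    rw [← zero_mul Complex.I] at h
    have h3 := HasDerivAt.scomp (h := fun t : ℂ => t * Complex.I) 0 h h2
    simpa [shiftedVec, annihSum, Function.comp_def, mul_smul] using h3
  | cons φ l ih =>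
    have h1 : HasDerivAt (fun t : ℂ => Complex.I * t * inner ℂ ψ φ) (Complex.I * inner ℂ ψ φ) 0 := by
      simpa using ((hasDerivAt_id (0 : ℂ)).const_mul Complex.I).mul_const (inner ℂ ψ φ)
    have h2 := (ih (m ++ [φ])).add (h1.smul (ih m))
    refine h2.congr_deriv ?_
    rw [annihSum_cons]
    simp only [zero_smul, mul_zero, zero_mul, shiftedVec_zero, List.append_assoc,
      List.singleton_append, smul_add, smul_smul]
    abel

/-- The field operator generates the one-parameter group `t ↦ W(tψ)`. -/
theorem hasDerivAt_weylOp (hE : IsExponential E) (ψ : 𝒦) (l : List 𝒦) :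
    HasDerivAt (fun t : ℝ => weylOp hE (t • ψ) (creationVec E l 0))
      (Complex.I • fieldOp (fun l => creationVec E l 0) ψ l) 0 := by
  have h1 := hasDerivAt_shiftedVec_param hE ψ l []
  have h2 : HasDerivAt (fun t : ℂ => Complex.exp (-(t ^ 2 * inner ℂ ψ ψ) / 2)) 0 0 := by
    have := ((((hasDerivAt_id (0 : ℂ)).pow 2).mul_const (inner ℂ ψ ψ : ℂ)).neg.div_const 2).cexp
    simpa using this
  have h3 := (h2.smul h1)
  have h4 := HasDerivAt.scomp_of_eq (h := fun t : ℝ => (t : ℂ)) (0 : ℝ) h3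
    (Complex.ofRealCLM.hasDerivAt (x := (0 : ℝ))) (by simp)
  refine (h4.congr_deriv ?_).congr_of_eventuallyEq (Filter.Eventually.of_forall fun t => ?_)
  · simp [fieldOp, annihSum]
  · simp only [Function.comp_apply, weylOp_creationVec, weylFactor, inner_zero_right, mul_zero,
      add_zero, zero_add]
    congr 1
    · rw [← Complex.coe_smul, inner_smul_left, inner_smul_right, Complex.conj_ofReal]
      ring_nf
    · congr 1
      rw [← Complex.coe_smul, smul_comm]

end WeylOperators

/-! ### Representations and norms of enveloping C*-algebras -/

section Enveloping

variable {B A : Type*} [Ring B] [Algebra ℂ B] [StarRing B] [CStarAlgebra A]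

theorem isCStarSeminorm_comp (ρ : B →⋆ₐ[ℂ] A) : IsCStarSeminorm fun b => ‖ρ b‖ where
  nonneg _ := norm_nonneg _
  add_le a b := by rw [map_add]; exact norm_add_le _ _
  smul c a := by rw [map_smul, norm_smul]
  mul_le a b := by rw [map_mul]; exact norm_mul_le _ _
  star_mul_self a := by rw [map_mul, map_star, CStarRing.norm_star_mul_self, sq]

variable [SpannedByUnitaries B]

namespace EnvelopingCStar

open UniformSpace

variable (B) in
/-- The canonical map to the enveloping C*-algebra as a linear map. -/
def ofLinear : B →ₗ[ℂ] EnvelopingCStar B where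
  toFun := of
  map_add' := of_add
  map_smul' := of_smul

theorem of_one : of (1 : B) = 1 := rfl

theorem denseRange_of : DenseRange (of : B → EnvelopingCStar B) := fun a =>
  induction_of (p := fun a => a ∈ closure (Set.range of)) a isClosed_closure
    fun b => subset_closure ⟨b, rfl⟩

/-- The universal property of the enveloping C*-algebra: `‖ρ b‖` is a C*-seminorm on `B`, hence bounded
by the largest one. -/
theorem exists_lift (ρ : B →⋆ₐ[ℂ] A) :
    ∃ π : EnvelopingCStar B →⋆ₐ[ℂ] A, Continuous π ∧ ∀ b, π (of b) = ρ b := by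
  let T : EnvelopingCStar B →L[ℂ] A :=
    LinearMap.extendOfNorm (ρ : B →ₗ[ℂ] A) (ofLinear B)
  have hT : ∀ b, T (of b) = ρ b := fun b =>
    LinearMap.extendOfNorm_eq (f := (ρ : B →ₗ[ℂ] A)) (e := ofLinear B) denseRange_of
      ⟨1, fun b => by
        rw [one_mul]
        exact (le_maxCStarSeminorm (isCStarSeminorm_comp ρ) b).trans_eq (norm_of b).symm⟩ b
  refine ⟨
    { toFun := T
      map_one' := by rw [← of_one, hT, map_one]
      map_zero' := map_zero T
      map_add' := map_add T
      map_mul' := fun a b => ?_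
      commutes' := fun c => by
        rw [Algebra.algebraMap_eq_smul_one, map_smul, ← of_one, hT, map_one,
          Algebra.algebraMap_eq_smul_one]
      map_star' := fun a => ?_ }, T.continuous, hT⟩
  · refine induction_of₂ (p := fun a b => T (a * b) = T a * T b) a b (isClosed_eq ?_ ?_) ?_
    · exact T.continuous.comp (continuous_fst.mul continuous_snd)
    · exact (T.continuous.comp continuous_fst).mul (T.continuous.comp continuous_snd)
    · intro a b
      rw [← of_mul, hT, hT, hT, map_mul]
  · refine induction_of (p := fun a => T (star a) = star (T a)) a (isClosed_eq ?_ ?_) ?_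
    · exact T.continuous.comp continuous_star'
    · exact T.continuous.star
    · intro b
      rw [star_of, hT, hT, map_star]

end EnvelopingCStar

/-- A C*-seminorm on a C*-algebra is dominated by the norm, up to the factor `2` that comes from writing
an element as a combination of four unitaries. -/
theorem IsCStarSeminorm.le_two_mul_norm {q : A → ℝ} (hq : IsCStarSeminorm q) (a : A) :
    q a ≤ 2 * ‖a‖ := by
  obtain ⟨u, c, ha, hc⟩ := CStarAlgebra.exists_sum_four_unitary a
  have h : ∀ i, q (c i • (u i : A)) ≤ ‖a‖ / 2 := fun i => by
    rw [hq.smul]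
    calc ‖c i‖ * q (u i) ≤ ‖c i‖ * 1 :=
          mul_le_mul_of_nonneg_left (hq.unitary_le (u i).2) (norm_nonneg _)
      _ ≤ ‖a‖ / 2 := by rw [mul_one]; exact hc i
  have h2 : q a ≤ ∑ i, q (c i • (u i : A)) := by
    conv_lhs => rw [ha]
    simp only [Fin.sum_univ_four]
    exact (hq.add_le _ _).trans (add_le_add ((hq.add_le _ _).trans (add_le_add
      (hq.add_le _ _) le_rfl)) le_rfl)
  have h3 : ∑ i, q (c i • (u i : A)) ≤ ∑ _i : Fin 4, ‖a‖ / 2 := Finset.sum_le_sum fun i _ => h i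
  simp only [Finset.sum_const, Finset.card_univ, Fintype.card_fin, nsmul_eq_mul] at h3
  push_cast at h3
  linarith

theorem norm_cstarTmul_le {A B : Type*} [CStarAlgebra A] [CStarAlgebra B] (a : A) (b : B) :
    ‖cstarTmul a b‖ ≤ 4 * ‖a‖ * ‖b‖ := by
  unfold cstarTmul
  rw [EnvelopingCStar.norm_of]
  refine ciSup_le fun q => ?_
  have ha : IsCStarSeminorm fun a : A => q.1 (a ⊗ₜ[ℂ] (1 : B)) :=
    { nonneg := fun _ => q.2.nonneg _
      add_le := fun a a' => by rw [TensorProduct.add_tmul]; exact q.2.add_le _ _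
      smul := fun c a => by rw [← TensorProduct.smul_tmul']; exact q.2.smul _ _
      mul_le := fun a a' => by
        have := q.2.mul_le (a ⊗ₜ[ℂ] (1 : B)) (a' ⊗ₜ[ℂ] (1 : B))
        rwa [Algebra.TensorProduct.tmul_mul_tmul, one_mul] at this
      star_mul_self := fun a => by
        have := q.2.star_mul_self (a ⊗ₜ[ℂ] (1 : B))
        rwa [TensorProduct.star_tmul, Algebra.TensorProduct.tmul_mul_tmul, star_one, one_mul]
          at this }
  have hb : IsCStarSeminorm fun b : B => q.1 ((1 : A) ⊗ₜ[ℂ] b) :=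
    { nonneg := fun _ => q.2.nonneg _
      add_le := fun a a' => by rw [TensorProduct.tmul_add]; exact q.2.add_le _ _
      smul := fun c a => by rw [TensorProduct.tmul_smul]; exact q.2.smul _ _
      mul_le := fun a a' => by
        have := q.2.mul_le ((1 : A) ⊗ₜ[ℂ] a) ((1 : A) ⊗ₜ[ℂ] a')
        rwa [Algebra.TensorProduct.tmul_mul_tmul, one_mul] at this
      star_mul_self := fun a => by
        have := q.2.star_mul_self ((1 : A) ⊗ₜ[ℂ] a)
        rwa [TensorProduct.star_tmul, Algebra.TensorProduct.tmul_mul_tmul, star_one, one_mul]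
          at this }
  -- The seminorm restricts to C*-seminorms on both factors.
  have h : q.1 (a ⊗ₜ[ℂ] b) ≤ q.1 (a ⊗ₜ[ℂ] (1 : B)) * q.1 ((1 : A) ⊗ₜ[ℂ] b) := by
    have := q.2.mul_le (a ⊗ₜ[ℂ] (1 : B)) ((1 : A) ⊗ₜ[ℂ] b)
    rwa [Algebra.TensorProduct.tmul_mul_tmul, one_mul, mul_one] at this
  refine h.trans ((mul_le_mul (ha.le_two_mul_norm a) (hb.le_two_mul_norm b) (q.2.nonneg _)
    (by positivity)).trans_eq (by ring))

/-- The elementary tensors as a continuous bilinear map. -/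
def cstarTmulCLM (A B : Type*) [CStarAlgebra A] [CStarAlgebra B] :
    A →L[ℂ] B →L[ℂ] CStarTensor A B :=
  LinearMap.mkContinuous₂ ((TensorProduct.mk ℂ A B).compr₂ (EnvelopingCStar.ofLinear (A ⊗[ℂ] B))) 4
    norm_cstarTmul_le

end Enveloping

/-! ### Representations of Weyl algebras -/

section WeylAlgebras

variable {V : Type*} [AddCommGroup V] [Module ℝ V] (σ : PresymplecticForm V)

theorem dense_span_weylGen :
    (Submodule.span ℂ (Set.range (weylGen σ))).topologicalClosure = ⊤ := by
  rw [← Submodule.dense_iff_topologicalClosure_eq_top]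
  refine EnvelopingCStar.denseRange_of.mono ?_
  rintro _ ⟨b, rfl⟩
  induction b using WeylPre.gen_induction with
  | h0 =>
    have : EnvelopingCStar.of (0 : WeylPre σ) = 0 := map_zero (EnvelopingCStar.ofLinear _)
    rw [this]
    exact zero_mem _
  | hadd a b ha hb => rw [EnvelopingCStar.of_add]; exact add_mem ha hb
  | hg c v =>
    rw [EnvelopingCStar.of_smul]
    exact Submodule.smul_mem _ _ (Submodule.subset_span ⟨v, rfl⟩)

variable {V₁ V₂ : Type*} [AddCommGroup V₁] [Module ℝ V₁] [AddCommGroup V₂] [Module ℝ V₂]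
  (σ₁ : PresymplecticForm V₁) (σ₂ : PresymplecticForm V₂)

/-- A continuous linear map on the tensor product of two Weyl algebras is determined by its values
on the tensor products of the generators. -/
theorem clm_ext_weylGen {F : Type*} [NormedAddCommGroup F] [NormedSpace ℂ F]
    {φ φ' : CStarTensor (WeylAlgebra σ₁) (WeylAlgebra σ₂) →L[ℂ] F}
    (h : ∀ v w, φ (cstarTmul (weylGen σ₁ v) (weylGen σ₂ w)) =
      φ' (cstarTmul (weylGen σ₁ v) (weylGen σ₂ w))) : φ = φ' := by
  have hd₁ := (Submodule.dense_iff_topologicalClosure_eq_top).2 (dense_span_weylGen σ₁)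
  have hd₂ := (Submodule.dense_iff_topologicalClosure_eq_top).2 (dense_span_weylGen σ₂)
  have h1 : ∀ v b, φ (cstarTmul (weylGen σ₁ v) b) = φ' (cstarTmul (weylGen σ₁ v) b) := by
    intro v b
    have : φ.comp (cstarTmulCLM _ _ (weylGen σ₁ v)) = φ'.comp (cstarTmulCLM _ _ (weylGen σ₁ v)) := by
      refine ContinuousLinearMap.ext_on hd₂ ?_
      rintro _ ⟨w, rfl⟩
      exact h v w
    exact congrArg (fun T => T b) this
  have h2 : ∀ a b, φ (cstarTmul a b) = φ' (cstarTmul a b) := by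
    intro a b
    have : φ.comp ((cstarTmulCLM _ _).flip b) = φ'.comp ((cstarTmulCLM _ _).flip b) := by
      refine ContinuousLinearMap.ext_on hd₁ ?_
      rintro _ ⟨w, rfl⟩
      exact h1 w b
    exact congrArg (fun T => T a) this
  ext x
  refine EnvelopingCStar.induction_of (p := fun x => φ x = φ' x) x
    (isClosed_eq φ.continuous φ'.continuous) fun t => ?_
  induction t using TensorProduct.induction_on with
  | zero =>
    have : EnvelopingCStar.of (0 : WeylAlgebra σ₁ ⊗[ℂ] WeylAlgebra σ₂) = 0 :=
      map_zero (EnvelopingCStar.ofLinear _)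
    rw [this, map_zero, map_zero]
  | tmul a b => exact h2 a b
  | add s t hs ht => rw [EnvelopingCStar.of_add, map_add, map_add, hs, ht]

variable {A : Type*} [CStarAlgebra A]

/-- Elements `W v` of a C*-algebra that satisfy the Weyl relations define a representation of the Weyl
C*-algebra. -/
theorem exists_weylRep (W : V → A) (h0 : W 0 = 1)
    (hmul : ∀ v w, W v * W w = Complex.exp (-(Complex.I / 2) * (σ.form v w : ℂ)) • W (v + w))
    (hstar : ∀ v, star (W v) = W (-v)) :
    ∃ π : WeylAlgebra σ →⋆ₐ[ℂ] A, Continuous π ∧ ∀ v, π (weylGen σ v) = W v := by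
  let T : WeylPre σ →ₗ[ℂ] A := Finsupp.linearCombination ℂ W
  have hT : ∀ v, T (WeylPre.gen σ v) = W v := fun v => by
    change Finsupp.linearCombination ℂ W (Finsupp.single v 1) = W v
    simp
  let ρ : WeylPre σ →⋆ₐ[ℂ] A :=
    { toFun := T
      map_one' := by rw [WeylPre.one_def, hT, h0]
      map_zero' := map_zero T
      map_add' := map_add T
      map_mul' := fun a b => by
        induction a using WeylPre.gen_induction with
        | h0 => simp
        | hadd a a' ha ha' => rw [add_mul, map_add, map_add, add_mul, ha, ha']
        | hg x u =>
        induction b using WeylPre.gen_induction with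
        | h0 => simp
        | hadd a a' ha ha' => rw [mul_add, map_add, map_add, mul_add, ha, ha']
        | hg y v =>
        simp only [smul_mul_assoc, mul_smul_comm, map_smul, WeylPre.gen_mul_gen, hT, hmul]
        rfl
      commutes' := fun c => by
        rw [Algebra.algebraMap_eq_smul_one, map_smul, WeylPre.one_def, hT, h0,
          Algebra.algebraMap_eq_smul_one]
      map_star' := fun a => by
        induction a using WeylPre.gen_induction with
        | h0 => simp
        | hadd a a' ha ha' => rw [star_add, map_add, map_add, star_add, ha, ha']
        | hg x u => rw [star_smul, WeylPre.star_gen, map_smul, map_smul, hT, hT, star_smul, hstar] }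
  obtain ⟨π, hc, hπ⟩ := EnvelopingCStar.exists_lift ρ
  exact ⟨π, hc, fun v => (hπ _).trans (hT v)⟩

/-- Elements `W v`, `v ∈ V₁ ⊕ V₂`, that satisfy the Weyl relations of `σ₁ ⊕ σ₂` define a representation of
`Weyl(V₁, σ₁) ⊗ Weyl(V₂, σ₂)`. -/
theorem exists_tensorRep (W : V₁ × V₂ → A) (h0 : W 0 = 1)
    (hmul : ∀ v w, W v * W w = Complex.exp (-(Complex.I / 2) *
      ((σ₁.form v.1 w.1 + σ₂.form v.2 w.2 : ℝ) : ℂ)) • W (v + w))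
    (hstar : ∀ v, star (W v) = W (-v)) :
    ∃ π : CStarTensor (WeylAlgebra σ₁) (WeylAlgebra σ₂) →⋆ₐ[ℂ] A, Continuous π ∧
      ∀ v : V₁ × V₂, π (cstarTmul (weylGen σ₁ v.1) (weylGen σ₂ v.2)) = W v := by
  obtain ⟨π₁, hc₁, h₁⟩ := exists_weylRep σ₁ (fun v => W (v, 0)) h0
    (fun v w => by rw [hmul]; simp) (fun v => by rw [hstar]; simp)
  obtain ⟨π₂, hc₂, h₂⟩ := exists_weylRep σ₂ (fun v => W (0, v)) h0
    (fun v w => by rw [hmul]; simp) (fun v => by rw [hstar]; simp)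
  have hcomm : ∀ a b, Commute (π₁ a) (π₂ b) := by
    have h3 : ∀ v w, Commute (W (v, 0)) (W (0, w)) := fun v w => by
      rw [commute_iff_eq, hmul, hmul]
      simp
    intro a b
    have hb : ∀ v, Commute (W (v, 0)) (π₂ b) := fun v => by
      refine (Submodule.dense_iff_topologicalClosure_eq_top.2 (dense_span_weylGen σ₂)).induction
        (P := fun b => Commute (W (v, 0)) (π₂ b)) (fun b hb => ?_) ?_ b
      · induction hb using Submodule.span_induction with
        | mem x hx => obtain ⟨w, rfl⟩ := hx; rw [h₂]; exact h3 v w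
        | zero => rw [map_zero]; exact Commute.zero_right _
        | add x y _ _ hx hy => rw [map_add]; exact hx.add_right hy
        | smul c x _ hx => rw [map_smul]; exact hx.smul_right c
      · exact isClosed_eq (continuous_const.mul hc₂) (hc₂.mul continuous_const)
    refine (Submodule.dense_iff_topologicalClosure_eq_top.2 (dense_span_weylGen σ₁)).induction
        (P := fun a => Commute (π₁ a) (π₂ b)) (fun a ha => ?_) ?_ a
    · induction ha using Submodule.span_induction with
      | mem x hx => obtain ⟨w, rfl⟩ := hx; rw [h₁]; exact hb w
      | zero => rw [map_zero]; exact Commute.zero_left _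
      | add x y _ _ hx hy => rw [map_add]; exact hx.add_left hy
      | smul c x _ hx => rw [map_smul]; exact hx.smul_left c
    · exact isClosed_eq (hc₁.mul continuous_const) (continuous_const.mul hc₁)
  let T := Algebra.TensorProduct.lift π₁.toAlgHom π₂.toAlgHom hcomm
  have hT : ∀ a b, T (a ⊗ₜ b) = π₁ a * π₂ b := fun a b => Algebra.TensorProduct.lift_tmul ..
  let ρ : (WeylAlgebra σ₁ ⊗[ℂ] WeylAlgebra σ₂) →⋆ₐ[ℂ] A :=
    { T with
      map_star' := fun t => by
        change T (star t) = star (T t)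
        induction t using TensorProduct.induction_on with
        | zero => simp
        | tmul a b =>
          rw [TensorProduct.star_tmul, hT, hT, star_mul, map_star, map_star, ← map_star, ← map_star]
          exact hcomm _ _
        | add s t hs ht => rw [star_add, map_add, map_add, star_add, hs, ht] }
  obtain ⟨π, hc, hπ⟩ := EnvelopingCStar.exists_lift ρ
  refine ⟨π, hc, fun v => (hπ _).trans ((hT _ _).trans ?_)⟩
  rw [h₁, h₂, hmul]
  simp

end WeylAlgebras

/-! ### The quasi-free state of a one-particle structure -/

section QuasiFree

universe u

open scoped ComplexOrder

variable {V₁ V₂ : Type u} [AddCommGroup V₁] [Module ℝ V₁] [AddCommGroup V₂] [Module ℝ V₂]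
  {σ₁ : PresymplecticForm V₁} {σ₂ : PresymplecticForm V₂}
  {μ : V₁ × V₂ →ₗ[ℝ] V₁ × V₂ →ₗ[ℝ] ℝ}
  {𝒦 : Type u} [NormedAddCommGroup 𝒦] [InnerProductSpace ℂ 𝒦] {K : V₁ × V₂ →ₗ[ℝ] 𝒦}

theorem im_inner_of_inner_eq
    (hK : ∀ v w, inner ℂ (K v) (K w) =
      (μ v w : ℂ) + Complex.I / 2 * ((σ₁.form v.1 w.1 + σ₂.form v.2 w.2 : ℝ) : ℂ))
    (v w : V₁ × V₂) :
    (inner ℂ (K v) (K w)).im = (σ₁.form v.1 w.1 + σ₂.form v.2 w.2) / 2 := by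
  rw [hK, show (μ v w : ℂ) + Complex.I / 2 * ((σ₁.form v.1 w.1 + σ₂.form v.2 w.2 : ℝ) : ℂ) =
    (μ v w : ℂ) + (((σ₁.form v.1 w.1 + σ₂.form v.2 w.2) / 2 : ℝ) : ℂ) * Complex.I by push_cast; ring,
    Complex.add_im, Complex.ofReal_im, Complex.im_ofReal_mul, Complex.I_im]
  ring

/-- The symplectic form does not contribute to the norm of `K v`. -/
theorem inner_self_of_inner_eq
    (hK : ∀ v w, inner ℂ (K v) (K w) =
      (μ v w : ℂ) + Complex.I / 2 * ((σ₁.form v.1 w.1 + σ₂.form v.2 w.2 : ℝ) : ℂ))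
    (v : V₁ × V₂) : inner ℂ (K v) (K v) = (μ v v : ℂ) := by
  rw [hK, σ₁.alt, σ₂.alt, add_zero, Complex.ofReal_zero, mul_zero, add_zero]

/-- The symplectic form is twice the imaginary part of the one-particle inner product, so that the
Cauchy–Schwarz inequality is the domination condition. -/
theorem dominates_of_inner_eq
    (hK : ∀ v w, inner ℂ (K v) (K w) =
      (μ v w : ℂ) + Complex.I / 2 * ((σ₁.form v.1 w.1 + σ₂.form v.2 w.2 : ℝ) : ℂ)) :
    Dominates μ σ₁ σ₂ := by
  intro v w
  have hn : ∀ v, ‖K v‖ = √(μ v v) := fun v => by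
    rw [norm_eq_sqrt_re_inner (𝕜 := ℂ), inner_self_of_inner_eq hK]
    rfl
  have h1 := (Complex.abs_im_le_norm _).trans (norm_inner_le_norm (𝕜 := ℂ) (K v) (K w))
  rw [im_inner_of_inner_eq hK, hn, hn, abs_div, abs_two] at h1
  linarith

theorem isQuasiFree_unique {φ φ' : CStarTensor (WeylAlgebra σ₁) (WeylAlgebra σ₂) →L[ℂ] ℂ}
    (h : IsQuasiFreeWith σ₁ σ₂ μ φ) (h' : IsQuasiFreeWith σ₁ σ₂ μ φ') : φ' = φ :=
  clm_ext_weylGen σ₁ σ₂ fun v w => (h'.apply_gen (v, w)).trans (h.apply_gen (v, w)).symm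

/-- Let `K` be a one-particle structure of `μ` with dense range.  Then the Weyl operators `W(K v)` on
the Fock space represent the Weyl algebra, and the vacuum is a cyclic vector for them that induces the
quasi-free state of `μ`. -/
theorem exists_quasiFree_fock [CompleteSpace 𝒦] (hμ : IsRealInnerProduct μ) (hd : DenseRange K)
    (hK : ∀ v w, inner ℂ (K v) (K w) =
      (μ v w : ℂ) + Complex.I / 2 * ((σ₁.form v.1 w.1 + σ₂.form v.2 w.2 : ℝ) : ℂ)) :
    ∃ φ : CStarTensor (WeylAlgebra σ₁) (WeylAlgebra σ₂) →L[ℂ] ℂ,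
      IsQuasiFreeWith σ₁ σ₂ μ φ ∧ HasFockRepresentation σ₁ σ₂ μ φ := by
  obtain ⟨H, _, _, _, E, hE⟩ := exists_isExponential 𝒦
  obtain ⟨π, hπc, hπ⟩ := exists_tensorRep σ₁ σ₂ (fun v => weylOp hE (K v))
    (by rw [map_zero, weylOp_zero])
    (fun v w => by
      rw [weylOp_mul, im_inner_of_inner_eq hK, map_add]
      congr 2
      push_cast
      ring)
    (fun v => by rw [star_weylOp, map_neg])
  let vac : H := creationVec E [] 0
  let φ : CStarTensor (WeylAlgebra σ₁) (WeylAlgebra σ₂) →L[ℂ] ℂ :=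
    { toFun := fun a => inner ℂ vac (π a vac)
      map_add' := fun a b => by rw [map_add, add_apply, inner_add_right]
      map_smul' := fun c a => by
        rw [map_smul, smul_apply, inner_smul_right, RingHom.id_apply, smul_eq_mul]
      cont := continuous_const.inner (hπc.clm_apply continuous_const) }
  have hφ : ∀ a, φ a = inner ℂ vac (π a vac) := fun _ => rfl
  have hfock := isFockSpace_creationVec hE
  have hstate : IsState φ :=
    { map_one := by
        rw [hφ, map_one, one_apply_eq_self, inner_self_eq_norm_sq_to_K, hfock.norm_vacuum]
        simp
      nonneg := fun a => by
        rw [hφ, map_mul, map_star, mul_apply_eq_comp, ContinuousLinearMap.star_eq_adjoint,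
          ContinuousLinearMap.adjoint_inner_right, inner_self_eq_norm_sq_to_K]
        have h0 := Complex.zero_le_real.2 (sq_nonneg ‖π a vac‖)
        rw [Complex.ofReal_pow] at h0
        exact h0 }
  have hqf : IsQuasiFreeWith σ₁ σ₂ μ φ :=
    { isState := hstate
      isInner := hμ
      dominates := dominates_of_inner_eq hK
      apply_gen := fun v => by
        rw [hφ, hπ, ← inner_self_of_inner_eq hK]
        exact inner_weylOp_vacuum hE (K v) }
  have hone : IsOneParticleStructure σ₁ σ₂ μ K :=
    { dense := hd.mono (by
        rintro _ ⟨v, rfl⟩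
        exact ⟨v, 0, by simp⟩)
      inner_eq := hK }
  -- The Weyl operators map the vacuum to multiples of the vectors `E (i K v)`, which are total because
  -- the range of `K` is dense and `E` is continuous.
  have hcyc : Dense (Set.range fun a => π a vac) := by
    let S : Submodule ℂ H := LinearMap.range
      ({ toFun := fun a => π a vac
         map_add' := fun a b => by rw [map_add, add_apply]
         map_smul' := fun c a => by rw [map_smul, smul_apply, RingHom.id_apply] } :
        CStarTensor (WeylAlgebra σ₁) (WeylAlgebra σ₂) →ₗ[ℂ] H)
    have h1 : ∀ v, E (Complex.I • K v) ∈ S := fun v => by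
      have h2 : weylOp hE (K v) (E 0) ∈ S := by
        rw [← hπ v]
        exact ⟨_, rfl⟩
      rw [weylOp_apply, zero_add] at h2
      exact (S.smul_mem_iff (Complex.exp_ne_zero _)).1 h2
    have h3 : ∀ χ, E χ ∈ S.topologicalClosure := by
      have h4 : ∀ χ, E (Complex.I • χ) ∈ S.topologicalClosure := fun χ =>
        hd.induction_on (p := fun χ => E (Complex.I • χ) ∈ S.topologicalClosure) χ
          (S.isClosed_topologicalClosure.preimage (hE.continuous.comp (continuous_const_smul _)))
          fun v => S.le_topologicalClosure (h1 v)
      intro χ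
      have h5 := h4 (-Complex.I • χ)
      rwa [smul_smul, mul_neg, Complex.I_mul_I, neg_neg, one_smul] at h5
    have h6 : S.topologicalClosure = ⊤ := by
      rw [eq_top_iff, ← hE.total]
      refine Submodule.topologicalClosure_minimal _ (Submodule.span_le.2 ?_)
        S.isClosed_topologicalClosure
      rintro _ ⟨χ, rfl⟩
      exact h3 χ
    exact Submodule.dense_iff_topologicalClosure_eq_top.2 h6
  refine ⟨φ, hqf, 𝒦, inferInstance, inferInstance, inferInstance, H, inferInstance, inferInstance,
    inferInstance, K, fun l => creationVec E l 0, π, hone, hfock, fun a => (hφ a).symm, hcyc,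
    fun v l => ?_⟩
  have h := hasDerivAt_weylOp hE (K v) l
  refine h.congr_of_eventuallyEq (Filter.Eventually.of_forall fun t => ?_)
  have h2 := hπ (t • v)
  rw [map_smul] at h2
  exact congrArg (fun T : H →L[ℂ] H => T (creationVec E l 0)) h2

end QuasiFree

/-! ### Complexification of a real inner product space -/

section Complexification

universe u

theorem IsRealInnerProduct.nonneg {V : Type*} [AddCommGroup V] [Module ℝ V]
    {B : V →ₗ[ℝ] V →ₗ[ℝ] ℝ} (hB : IsRealInnerProduct B) (v : V) : 0 ≤ B v v := by
  rcases eq_or_ne v 0 with rfl | hv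
  · simp
  · exact (hB.pos v hv).le

theorem IsRealInnerProduct.eq_zero {V : Type*} [AddCommGroup V] [Module ℝ V]
    {B : V →ₗ[ℝ] V →ₗ[ℝ] ℝ} (hB : IsRealInnerProduct B) {v : V} (h : B v v = 0) : v = 0 := by
  by_contra hv
  exact (hB.pos v hv).ne' h

theorem isRealInnerProduct_of_nonneg {V : Type*} [AddCommGroup V] [Module ℝ V]
    {B : V →ₗ[ℝ] V →ₗ[ℝ] ℝ} (hsymm : ∀ v w, B v w = B w v) (hnonneg : ∀ v, 0 ≤ B v v)
    (hdef : ∀ v, B v v = 0 → v = 0) : IsRealInnerProduct B :=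
  ⟨hsymm, fun v hv => lt_of_le_of_ne (hnonneg v) fun h => hv (hdef v h.symm)⟩

/-- The complexification `X ⊕ iX` of a real vector space; the pair `(x, y)` stands for `x + iy`. -/
def Complexification (X : Type*) : Type _ := X × X

namespace Complexification

variable {X : Type*} [AddCommGroup X] [Module ℝ X]

instance : AddCommGroup (Complexification X) := inferInstanceAs (AddCommGroup (X × X))

instance : Module ℂ (Complexification X) where
  smul c x := (c.re • x.1 - c.im • x.2, c.re • x.2 + c.im • x.1)
  one_smul x := Prod.ext (by change (1 : ℂ).re • x.1 - (1 : ℂ).im • x.2 = x.1; simp)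
    (by change (1 : ℂ).re • x.2 + (1 : ℂ).im • x.1 = x.2; simp)
  mul_smul c d x := Prod.ext
    (by
      change (c * d).re • x.1 - (c * d).im • x.2 =
        c.re • (d.re • x.1 - d.im • x.2) - c.im • (d.re • x.2 + d.im • x.1)
      rw [Complex.mul_re, Complex.mul_im]
      module)
    (by
      change (c * d).re • x.2 + (c * d).im • x.1 =
        c.re • (d.re • x.2 + d.im • x.1) + c.im • (d.re • x.1 - d.im • x.2)
      rw [Complex.mul_re, Complex.mul_im]
      module)
  smul_zero c := Prod.ext (by change c.re • (0 : X) - c.im • (0 : X) = 0; simp)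
    (by change c.re • (0 : X) + c.im • (0 : X) = 0; simp)
  smul_add c x y := Prod.ext
    (by
      change c.re • (x.1 + y.1) - c.im • (x.2 + y.2) =
        (c.re • x.1 - c.im • x.2) + (c.re • y.1 - c.im • y.2)
      module)
    (by
      change c.re • (x.2 + y.2) + c.im • (x.1 + y.1) =
        (c.re • x.2 + c.im • x.1) + (c.re • y.2 + c.im • y.1)
      module)
  add_smul c d x := Prod.ext
    (by
      change (c + d).re • x.1 - (c + d).im • x.2 =
        (c.re • x.1 - c.im • x.2) + (d.re • x.1 - d.im • x.2)
      rw [Complex.add_re, Complex.add_im]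
      module)
    (by
      change (c + d).re • x.2 + (c + d).im • x.1 =
        (c.re • x.2 + c.im • x.1) + (d.re • x.2 + d.im • x.1)
      rw [Complex.add_re, Complex.add_im]
      module)
  zero_smul x := Prod.ext (by change (0 : ℂ).re • x.1 - (0 : ℂ).im • x.2 = 0; simp)
    (by change (0 : ℂ).re • x.2 + (0 : ℂ).im • x.1 = 0; simp)

omit [Module ℝ X] in
theorem fst_add (x y : Complexification X) : (x + y).1 = x.1 + y.1 := rfl
omit [Module ℝ X] in
theorem snd_add (x y : Complexification X) : (x + y).2 = x.2 + y.2 := rfl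
theorem fst_smul (c : ℂ) (x : Complexification X) : (c • x).1 = c.re • x.1 - c.im • x.2 := rfl
theorem snd_smul (c : ℂ) (x : Complexification X) : (c • x).2 = c.re • x.2 + c.im • x.1 := rfl

/-- The vector `x + iy` for the pair `(x, y)`. -/
def mk (v : X × X) : Complexification X := v

theorem mk_smul (c : ℝ) (v : X × X) : mk (c • v) = (c : ℂ) • mk v := by
  refine Prod.ext ?_ ?_
  · rw [fst_smul, Complex.ofReal_re, Complex.ofReal_im, zero_smul, sub_zero]
    rfl
  · rw [snd_smul, Complex.ofReal_re, Complex.ofReal_im, zero_smul, add_zero]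
    rfl

/-- The complex inner product on the complexification that extends half of a real inner product. -/
abbrev innerCore (β : X →ₗ[ℝ] X →ₗ[ℝ] ℝ) (hβ : IsRealInnerProduct β) :
    InnerProductSpace.Core ℂ (Complexification X) where
  inner x y := ⟨1 / 2 * (β x.1 y.1 + β x.2 y.2), 1 / 2 * (β x.1 y.2 - β x.2 y.1)⟩
  conj_inner_symm x y := by
    apply Complex.ext
    · change 1 / 2 * (β y.1 x.1 + β y.2 x.2) = 1 / 2 * (β x.1 y.1 + β x.2 y.2)
      rw [hβ.symm y.1, hβ.symm y.2]
    · change -(1 / 2 * (β y.1 x.2 - β y.2 x.1)) = 1 / 2 * (β x.1 y.2 - β x.2 y.1)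
      rw [hβ.symm y.1, hβ.symm y.2]
      ring
  re_inner_nonneg x := by
    change 0 ≤ 1 / 2 * (β x.1 x.1 + β x.2 x.2)
    have h1 := hβ.nonneg x.1
    have h2 := hβ.nonneg x.2
    positivity
  add_left x y z := by
    apply Complex.ext
    · change 1 / 2 * (β (x + y).1 z.1 + β (x + y).2 z.2) =
        1 / 2 * (β x.1 z.1 + β x.2 z.2) + 1 / 2 * (β y.1 z.1 + β y.2 z.2)
      simp only [fst_add, snd_add, map_add, LinearMap.add_apply]
      ring
    · change 1 / 2 * (β (x + y).1 z.2 - β (x + y).2 z.1) =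
        1 / 2 * (β x.1 z.2 - β x.2 z.1) + 1 / 2 * (β y.1 z.2 - β y.2 z.1)
      simp only [fst_add, snd_add, map_add, LinearMap.add_apply]
      ring
  smul_left x y c := by
    apply Complex.ext
    · change 1 / 2 * (β (c • x).1 y.1 + β (c • x).2 y.2) =
        c.re * (1 / 2 * (β x.1 y.1 + β x.2 y.2)) - -c.im * (1 / 2 * (β x.1 y.2 - β x.2 y.1))
      simp only [fst_smul, snd_smul, map_add, map_sub, map_smul, LinearMap.add_apply,
        LinearMap.sub_apply, LinearMap.smul_apply, smul_eq_mul]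
      ring
    · change 1 / 2 * (β (c • x).1 y.2 - β (c • x).2 y.1) =
        c.re * (1 / 2 * (β x.1 y.2 - β x.2 y.1)) + -c.im * (1 / 2 * (β x.1 y.1 + β x.2 y.2))
      simp only [fst_smul, snd_smul, map_add, map_sub, map_smul, LinearMap.add_apply,
        LinearMap.sub_apply, LinearMap.smul_apply, smul_eq_mul]
      ring
  definite x hx := by
    have h0 : 1 / 2 * (β x.1 x.1 + β x.2 x.2) = 0 := congrArg Complex.re hx
    have h1 := hβ.nonneg x.1
    have h2 := hβ.nonneg x.2
    exact Prod.ext (hβ.eq_zero (by linarith)) (hβ.eq_zero (by linarith))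

end Complexification

/-- The completed complexification of a real inner product space `(X, β)` is a complex Hilbert space
that contains a copy of `X ⊕ X`, densely, with real part `(β ⊕ β) / 2` of the inner product and the
symplectic form of `β` as twice the imaginary part. -/
theorem exists_complexification {X : Type u} [AddCommGroup X] [Module ℝ X]
    (β : X →ₗ[ℝ] X →ₗ[ℝ] ℝ) (hβ : IsRealInnerProduct β) :
    ∃ (𝒦 : Type u) (_ : NormedAddCommGroup 𝒦) (_ : InnerProductSpace ℂ 𝒦) (_ : CompleteSpace 𝒦)
      (K : X × X →ₗ[ℝ] 𝒦), DenseRange K ∧ ∀ v w, inner ℂ (K v) (K w) =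
        ((1 / 2 * (β v.1 w.1 + β v.2 w.2) : ℝ) : ℂ) +
          Complex.I / 2 * ((β v.1 w.2 - β v.2 w.1 : ℝ) : ℂ) := by
  let core := Complexification.innerCore β hβ
  let : NormedAddCommGroup (Complexification X) := core.toNormedAddCommGroup
  let : InnerProductSpace ℂ (Complexification X) := InnerProductSpace.ofCore core.toCore
  refine ⟨UniformSpace.Completion (Complexification X), inferInstance, inferInstance,
    inferInstance,
    { toFun := fun v => ((Complexification.mk v : Complexification X) :
        UniformSpace.Completion (Complexification X))
      map_add' := fun v w => UniformSpace.Completion.coe_add (α := Complexification X) v w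
      map_smul' := fun c v => ?_ }, ?_, fun v w => ?_⟩
  · rw [Complexification.mk_smul, UniformSpace.Completion.coe_smul]
    rfl
  · exact UniformSpace.Completion.denseRange_coe (α := Complexification X)
  · refine (UniformSpace.Completion.inner_coe (E := Complexification X) v w).trans ?_
    apply Complex.ext
    · change 1 / 2 * (β v.1 w.1 + β v.2 w.2) = _
      simp
    · change 1 / 2 * (β v.1 w.2 - β v.2 w.1) = _
      simp

end Complexification

/-! ### Positivity of the volume and of the boundary area -/

section Positivity

open Bundle Set MeasureTheory

variable {M : Type*} [TopologicalSpace M] [ChartedSpace (EuclideanHalfSpace 3) M]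
    [IsManifold (𝓡∂ 3) ∞ M]

theorem apply_sharp_self_nonneg (g : Metric3 M) (p : M) (η : TangentSpace (𝓡∂ 3) p →L[ℝ] ℝ) :
    0 ≤ η (sharp g p η) := by
  rw [← inner_sharp g p η]
  by_cases h : sharp g p η = 0
  · rw [h, map_zero]
  · exact (g.pos p _ h).le

theorem apply_sharp_self_eq_zero (g : Metric3 M) (p : M) (η : TangentSpace (𝓡∂ 3) p →L[ℝ] ℝ)
    (h : η (sharp g p η) = 0) : η = 0 := by
  rw [← inner_sharp g p η] at h
  have h0 : sharp g p η = 0 := by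
    by_contra hne
    exact (g.pos p _ hne).ne' h
  ext v
  rw [← inner_sharp g p η, h0, map_zero]

omit [IsManifold (𝓡∂ 3) ∞ M] in
/-- In the chart at `x₀`, an open subset of the manifold is the trace on the half-space of an open
subset of `ℝ³`. -/
theorem exists_isOpen_chart_preimage (x₀ : M) {U : Set M} (hU : IsOpen U) :
    ∃ O : Set E3, IsOpen O ∧ (extChartAt (𝓡∂ 3) x₀).target ∩ (extChartAt (𝓡∂ 3) x₀).symm ⁻¹' U =
      O ∩ range (𝓡∂ 3) := by
  refine ⟨(𝓡∂ 3).symm ⁻¹' ((chartAt (EuclideanHalfSpace 3) x₀).target ∩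
    (chartAt (EuclideanHalfSpace 3) x₀).symm ⁻¹' U),
    ((chartAt (EuclideanHalfSpace 3) x₀).isOpen_inter_preimage_symm hU).preimage
      (𝓡∂ 3).continuous_symm, ?_⟩
  rw [extChartAt_target, extChartAt_coe_symm]
  ext y
  simp only [mem_inter_iff, mem_preimage, Function.comp_apply]
  tauto

variable [T2Space M] [CompactSpace M] [MeasurableSpace M] [BorelSpace M]

/-- A measure that is put together from positive continuous densities is positive on every
neighbourhood, in the image of the parametrisation `j` of the charts, of a point of this image. -/
theorem chartMeasure_ne_zero {X : Type*} [MeasureSpace X] [TopologicalSpace X] [BorelSpace X]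
    {j : X → E3} (hj : Continuous j)
    (hvol : ∀ O : Set E3, IsOpen O → (j ⁻¹' (O ∩ range (𝓡∂ 3))).Nonempty →
      volume (j ⁻¹' (O ∩ range (𝓡∂ 3))) ≠ 0)
    {dens : M → M → ℝ}
    (hd : ∀ i, ContinuousOn (dens i) (chartAt (EuclideanHalfSpace 3) i).source)
    (hpos : ∀ i, ∀ p ∈ (chartAt (EuclideanHalfSpace 3) i).source, 0 < dens i p)
    {U S : Set M} (hU : IsOpen U) {p : M} (hp : p ∈ U)
    (hpj : ∀ i, p ∈ (chartAt (EuclideanHalfSpace 3) i).source → extChartAt (𝓡∂ 3) i p ∈ range j)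
    (hS : ∀ i z, j z ∈ (extChartAt (𝓡∂ 3) i).target →
      (extChartAt (𝓡∂ 3) i).symm (j z) ∈ U → (extChartAt (𝓡∂ 3) i).symm (j z) ∈ S) :
    chartMeasure j dens S ≠ 0 := by
  obtain ⟨i, hi⟩ := (chartPartition M).exists_pos_of_mem (mem_univ p)
  set φ := extChartAt (𝓡∂ 3) i with hφ
  have hps : p ∈ (chartAt (EuclideanHalfSpace 3) i).source :=
    chartPartition_subordinate i (subset_tsupport _ hi.ne')
  have hps' : p ∈ φ.source := by rw [hφ, extChartAt_source]; exact hps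
  have hρ : Continuous (chartPartition M i) := (chartPartition M i).contMDiff.continuous
  obtain ⟨O, hO, hOeq⟩ := exists_isOpen_chart_preimage i
    (hU.inter (isOpen_lt continuous_const hρ))
  rw [← hφ] at hOeq
  set G := j ⁻¹' (O ∩ range (𝓡∂ 3)) with hG
  have hGmem : ∀ z ∈ G, j z ∈ φ.target ∧ φ.symm (j z) ∈ U ∧
      0 < chartPartition M i (φ.symm (j z)) := by
    intro z hz
    rw [hG, ← hOeq] at hz
    exact ⟨hz.1, hz.2.1, hz.2.2⟩
  have hGm : MeasurableSet G :=
    hj.measurable (hO.measurableSet.inter (𝓡∂ 3).isClosed_range.measurableSet)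
  have hGne : G.Nonempty := by
    obtain ⟨z, hz⟩ := hpj i hps
    refine ⟨z, ?_⟩
    rw [hG, ← hOeq, mem_preimage, hz]
    refine ⟨φ.map_source hps', ?_⟩
    rw [mem_preimage, φ.left_inv hps']
    exact ⟨hp, hi⟩
  set T := j ⁻¹' φ.target with hT
  have hGT : G ⊆ T := fun z hz => (hGmem z hz).1
  have hTm : MeasurableSet T := hj.measurable (measurableSet_chart_target i)
  have hcont : ContinuousOn (fun z => φ.symm (j z)) T :=
    (continuousOn_extChartAt_symm i).comp hj.continuousOn fun z hz => hz
  have hmaps : MapsTo (fun z => φ.symm (j z)) T (chartAt (EuclideanHalfSpace 3) i).source :=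
    fun z hz => by
      have := φ.map_target hz
      rwa [hφ, extChartAt_source] at this
  set d : X → ENNReal := fun z =>
    ENNReal.ofReal (chartPartition M i (φ.symm (j z)) * dens i (φ.symm (j z))) with hd'
  have hdc : ContinuousOn d T := ENNReal.continuous_ofReal.comp_continuousOn
    ((hρ.comp_continuousOn hcont).mul ((hd i).comp hcont hmaps))
  have hfm : AEMeasurable (fun z => φ.symm (j z)) ((volume.restrict T).withDensity d) :=
    (hcont.aemeasurable hTm).mono_ac (withDensity_absolutelyContinuous _ _)
  have hle : ∫⁻ z in G, d z ≤ chartMeasure j dens S := by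
    calc ∫⁻ z in G, d z = (volume.restrict T).withDensity d G := by
          rw [withDensity_apply _ hGm, Measure.restrict_restrict hGm, inter_eq_left.2 hGT]
      _ ≤ (volume.restrict T).withDensity d ((fun z => φ.symm (j z)) ⁻¹' S) :=
          measure_mono fun z hz => hS i z (hGmem z hz).1 (hGmem z hz).2.1
      _ ≤ Measure.map (fun z => φ.symm (j z)) ((volume.restrict T).withDensity d) S :=
          Measure.le_map_apply hfm S
      _ ≤ chartMeasure j dens S := Measure.le_sum (fun i : M =>
          Measure.map (fun z => (extChartAt (𝓡∂ 3) i).symm (j z))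
          ((volume.restrict (j ⁻¹' (extChartAt (𝓡∂ 3) i).target)).withDensity fun z =>
            ENNReal.ofReal (chartPartition M i ((extChartAt (𝓡∂ 3) i).symm (j z)) *
              dens i ((extChartAt (𝓡∂ 3) i).symm (j z))))) i S
  intro h0
  rw [h0, nonpos_iff_eq_zero, lintegral_eq_zero_iff' ((hdc.mono hGT).aemeasurable hGm)] at hle
  refine hvol O hO hGne ?_
  rw [Filter.EventuallyEq, ae_restrict_iff' hGm] at hle
  refine measure_mono_null (fun z hz => ?_) hle
  intro h1
  have h2 := h1 hz
  simp only [hd', Pi.zero_apply, ENNReal.ofReal_eq_zero] at h2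
  exact (mul_pos (hGmem z hz).2.2 (hpos i _ (hmaps (hGT hz)))).not_ge h2

/-- Boundary points need no special treatment, because every relatively open subset of the half-space
contains interior points. -/
theorem riemannianVolume_ne_zero (g : Metric3 M) {U : Set M} (hU : IsOpen U) (hne : U.Nonempty) :
    riemannianVolume g U ≠ 0 := by
  obtain ⟨p, hp⟩ := hne
  refine chartMeasure_ne_zero continuous_id (fun O hO hne => ?_)
    (fun i => (smooth_sqrt_det g i).continuousOn)
    (fun i q hq => Real.sqrt_pos.2 (gram_posDef g hq).det_pos) hU hp (fun i _ => ⟨_, rfl⟩)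
    fun i z _ h => h
  obtain ⟨y, hyO, hyr⟩ := hne
  have hconv : Convex ℝ (range (𝓡∂ 3)) := (𝓡∂ 3).convex_range
  have hint : (interior (range (𝓡∂ 3))).Nonempty := (𝓡∂ 3).nonempty_interior
  have hcl : y ∈ closure (interior (range (𝓡∂ 3))) := by
    rw [hconv.closure_interior_eq_closure_of_nonempty_interior hint]
    exact subset_closure hyr
  obtain ⟨w, hw⟩ := mem_closure_iff.1 hcl O hO hyO
  have hpos := (hO.inter isOpen_interior).measure_pos (volume : Measure E3) ⟨w, hw⟩
  exact (hpos.trans_le (measure_mono (inter_subset_inter_right _ interior_subset))).ne'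

omit [T2Space M] [CompactSpace M] [MeasurableSpace M] [BorelSpace M] in
theorem mem_boundary_of_boundaryEmbed {i : M} {z : EuclideanSpace ℝ (Fin 2)}
    (hz : boundaryEmbed z ∈ (extChartAt (𝓡∂ 3) i).target) :
    (extChartAt (𝓡∂ 3) i).symm (boundaryEmbed z) ∈ (𝓡∂ 3).boundary M := by
  have hs := (extChartAt (𝓡∂ 3) i).map_target hz
  rw [extChartAt_source] at hs
  refine ((𝓡∂ 3).isBoundaryPoint_iff_of_mem_atlas (n := ∞) (by simp)
    (chart_mem_atlas (EuclideanHalfSpace 3) i) hs).2 ?_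
  change extChartAt (𝓡∂ 3) i ((extChartAt (𝓡∂ 3) i).symm (boundaryEmbed z)) ∈ frontier _
  rw [(extChartAt (𝓡∂ 3) i).right_inv hz]
  refine ⟨subset_closure hz, fun hint => ?_⟩
  have h1 := interior_mono (extChartAt_target_subset_range (I := 𝓡∂ 3) i) hint
  rw [interior_range_modelWithCornersEuclideanHalfSpace] at h1
  exact lt_irrefl (0 : ℝ) h1

theorem boundaryArea_ne_zero (g : Metric3 M) {U : Set ((𝓡∂ 3).boundary M)} (hU : IsOpen U)
    (hne : U.Nonempty) : boundaryArea g U ≠ 0 := by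
  obtain ⟨p, hp⟩ := hne
  obtain ⟨U', hU', rfl⟩ := isOpen_induced_iff.1 hU
  have hc : IsClosed ((𝓡∂ 3).boundary M) := (𝓡∂ 3).isClosed_boundary (n := ∞) (by simp)
  unfold boundaryArea
  rw [(MeasurableEmbedding.subtype_coe hc.measurableSet).comap_apply]
  refine chartMeasure_ne_zero isClosedEmbedding_boundaryEmbed.continuous (fun O hO hne => ?_)
    (fun i => ?_) (fun i q hq => ?_) hU' (p := p.1) hp (fun i hi => ?_) fun i z hz h => ?_
  · have hr : boundaryEmbed ⁻¹' (O ∩ range (𝓡∂ 3)) = boundaryEmbed ⁻¹' O := by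
      ext z
      refine ⟨fun h => h.1, fun h => ⟨h, ?_⟩⟩
      rw [range_modelWithCornersEuclideanHalfSpace]
      exact le_refl (0 : ℝ)
    rw [hr] at hne ⊢
    exact ((hO.preimage isClosedEmbedding_boundaryEmbed.continuous).measure_pos _ hne).ne'
  · refine ContinuousOn.sqrt ?_
    have hg := fun a b => (smooth_gram g i a b).continuousOn
    simp only [Matrix.det_fin_two, Matrix.submatrix_apply]
    exact ((hg _ _).mul (hg _ _)).sub ((hg _ _).mul (hg _ _))
  · exact Real.sqrt_pos.2 (((gram_posDef g hq).submatrix (Fin.succ_injective 2)).det_pos)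
  · refine ⟨!₂[extChartAt (𝓡∂ 3) i p.1 1, extChartAt (𝓡∂ 3) i p.1 2], ?_⟩
    ext k
    fin_cases k
    · exact (boundary_coord hi p.2).symm
    · rfl
    · rfl
  · exact ⟨⟨_, mem_boundary_of_boundaryEmbed hz⟩, h, rfl⟩

theorem eq_zero_of_integral_eq_zero {X : Type*} [TopologicalSpace X] [MeasurableSpace X]
    {ν : Measure X} (hν : ∀ U : Set X, IsOpen U → U.Nonempty → ν U ≠ 0) {f : X → ℝ}
    (hf : Continuous f) (hi : Integrable f ν) (h0 : ∀ x, 0 ≤ f x) (h : ∫ x, f x ∂ν = 0) (x : X) :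
    f x = 0 := by
  rw [integral_eq_zero_iff_of_nonneg h0 hi] at h
  by_contra hx
  exact hν {x | f x ≠ 0} (isOpen_ne_fun hf continuous_const) ⟨x, hx⟩ h

theorem isRealInnerProduct_loopPairing (g : Metric3 M) : IsRealInnerProduct (loopPairing g) := by
  refine isRealInnerProduct_of_nonneg (fun α β => formPairing_symm g α.1 β.1)
    (fun α => integral_nonneg fun p => apply_sharp_self_nonneg g p _) fun α h => ?_
  have h1 := eq_zero_of_integral_eq_zero (fun U => riemannianVolume_ne_zero g)
    (continuous_apply_sharp g α.1 α.1) (integrable_pairing g α.1 α.1)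
    (fun p => apply_sharp_self_nonneg g p _) h
  exact Subtype.ext (OneForm.ext fun p => apply_sharp_self_eq_zero g p _ (h1 p))

theorem isRealInnerProduct_boundaryPairing (g : Metric3 M) :
    IsRealInnerProduct (boundaryPairingBilin g) := by
  refine isRealInnerProduct_of_nonneg (fun f h => boundaryPairing_symm g f.1 h.1)
    (fun f => integral_nonneg fun p => mul_self_nonneg _) fun f h => ?_
  have hc : Continuous f.1 := by
    obtain ⟨_, α, _, rfl⟩ := f
    exact continuous_normalTrace g α
  have h1 := eq_zero_of_integral_eq_zero (fun U => boundaryArea_ne_zero g)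
    (hc.mul hc) (integrable_boundary g f f) (fun p => mul_self_nonneg _) h
  exact Subtype.ext (funext fun p => mul_self_eq_zero.1 (h1 p))

end Positivity

/-! ### Doubled inner product spaces -/

section DoubledSpaces

universe u

variable {V W : Type u} [AddCommGroup V] [Module ℝ V] [AddCommGroup W] [Module ℝ W]
  {B : V →ₗ[ℝ] V →ₗ[ℝ] ℝ} {b : W →ₗ[ℝ] W →ₗ[ℝ] ℝ}

/-- The orthogonal direct sum of two bilinear forms. -/
def directSumForm (B : V →ₗ[ℝ] V →ₗ[ℝ] ℝ) (b : W →ₗ[ℝ] W →ₗ[ℝ] ℝ) :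
    V × W →ₗ[ℝ] V × W →ₗ[ℝ] ℝ :=
  B.compl₁₂ (LinearMap.fst ℝ V W) (LinearMap.fst ℝ V W) +
    b.compl₁₂ (LinearMap.snd ℝ V W) (LinearMap.snd ℝ V W)

theorem directSumForm_apply (v w : V × W) :
    directSumForm B b v w = B v.1 w.1 + b v.2 w.2 := rfl

theorem isRealInnerProduct_directSumForm (hB : IsRealInnerProduct B) (hb : IsRealInnerProduct b) :
    IsRealInnerProduct (directSumForm B b) := by
  refine isRealInnerProduct_of_nonneg (fun v w => ?_) (fun v => ?_) fun v h => ?_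
  · rw [directSumForm_apply, directSumForm_apply, hB.symm, hb.symm]
  · exact add_nonneg (hB.nonneg _) (hb.nonneg _)
  · rw [directSumForm_apply] at h
    have h1 := hB.nonneg v.1
    have h2 := hb.nonneg v.2
    exact Prod.ext (hB.eq_zero (by linarith)) (hb.eq_zero (by linarith))

theorem halfSumForm_apply (v w : (V × V) × (W × W)) : halfSumForm B b v w =
    1 / 2 * (B v.1.1 w.1.1 + B v.1.2 w.1.2 + b v.2.1 w.2.1 + b v.2.2 w.2.2) := rfl

theorem isRealInnerProduct_halfSumForm (hB : IsRealInnerProduct B) (hb : IsRealInnerProduct b) :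
    IsRealInnerProduct (halfSumForm B b) := by
  refine isRealInnerProduct_of_nonneg (fun v w => ?_) (fun v => ?_) fun v h => ?_
  · rw [halfSumForm_apply, halfSumForm_apply, hB.symm v.1.1, hB.symm v.1.2, hb.symm v.2.1,
      hb.symm v.2.2]
  all_goals
    have h1 := hB.nonneg v.1.1
    have h2 := hB.nonneg v.1.2
    have h3 := hb.nonneg v.2.1
    have h4 := hb.nonneg v.2.2
  · rw [halfSumForm_apply]
    positivity
  · rw [halfSumForm_apply] at h
    exact Prod.ext
      (Prod.ext (hB.eq_zero (by linarith)) (hB.eq_zero (by linarith)))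
      (Prod.ext (hb.eq_zero (by linarith)) (hb.eq_zero (by linarith)))

/-- The one-particle structure of `halfSumForm B b`: it sends `F ⊕ H ⊕ f ⊕ h` to
`(F ⊕ f) + i (H ⊕ h)`, up to the normalisation of the inner product, and its range is dense. -/
theorem exists_oneParticle_halfSumForm (hB : IsRealInnerProduct B) (hb : IsRealInnerProduct b) :
    ∃ (𝒦 : Type u) (_ : NormedAddCommGroup 𝒦) (_ : InnerProductSpace ℂ 𝒦) (_ : CompleteSpace 𝒦)
      (K : (V × V) × (W × W) →ₗ[ℝ] 𝒦), DenseRange K ∧ ∀ v w, inner ℂ (K v) (K w) =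
        (halfSumForm B b v w : ℂ) + Complex.I / 2 *
          (((doubledForm B).form v.1 w.1 + (doubledForm b).form v.2 w.2 : ℝ) : ℂ) := by
  obtain ⟨𝒦, i₁, i₂, i₃, K, hd, hK⟩ :=
    exists_complexification (directSumForm B b) (isRealInnerProduct_directSumForm hB hb)
  let e := LinearEquiv.prodProdProdComm ℝ V V W W
  refine ⟨𝒦, i₁, i₂, i₃, K ∘ₗ e.toLinearMap, ?_, fun v w => ?_⟩
  · have h : Set.range (K ∘ₗ e.toLinearMap) = Set.range K := e.surjective.range_comp K
    rw [DenseRange, h]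
    exact hd
  · refine (hK (e v) (e w)).trans ?_
    congr 3
    · change (B v.1.1 w.1.1 + b v.2.1 w.2.1) + (B v.1.2 w.1.2 + b v.2.2 w.2.2) =
        B v.1.1 w.1.1 + B v.1.2 w.1.2 + b v.2.1 w.2.1 + b v.2.2 w.2.2
      ring
    · change (B v.1.1 w.1.2 + b v.2.1 w.2.2) - (B v.1.2 w.1.1 + b v.2.2 w.2.1) =
        (B v.1.1 w.1.2 - B w.1.1 v.1.2) + (b v.2.1 w.2.2 - b w.2.1 v.2.2)
      rw [hB.symm v.1.2, hb.symm v.2.2]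
      ring

/-- The form `halfSumForm B b` dominates the symplectic forms of the doubled spaces and determines a
unique quasi-free state, whose GNS representation is a Fock representation. -/
theorem exists_quasiFree_halfSumForm (hB : IsRealInnerProduct B) (hb : IsRealInnerProduct b) :
    IsRealInnerProduct (halfSumForm B b) ∧
    Dominates (halfSumForm B b) (doubledForm B) (doubledForm b) ∧
    ∃ φ : CStarTensor (WeylAlgebra (doubledForm B)) (WeylAlgebra (doubledForm b)) →L[ℂ] ℂ,
      IsQuasiFreeWith (doubledForm B) (doubledForm b) (halfSumForm B b) φ ∧
      (∀ φ', IsQuasiFreeWith (doubledForm B) (doubledForm b) (halfSumForm B b) φ' → φ' = φ) ∧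
      HasFockRepresentation (doubledForm B) (doubledForm b) (halfSumForm B b) φ := by
  have hμ := isRealInnerProduct_halfSumForm hB hb
  obtain ⟨𝒦, _, _, _, K, hd, hK⟩ := exists_oneParticle_halfSumForm hB hb
  obtain ⟨φ, hφ, hF⟩ := exists_quasiFree_fock hμ hd hK
  exact ⟨hμ, hφ.dominates, φ, hφ, fun φ' h' => isQuasiFree_unique hφ h', hF⟩

end DoubledSpaces

end L2Rep

end

theorem mainTheorem12 {M : Type*} [TopologicalSpace M]
    [ChartedSpace (EuclideanHalfSpace 3) M] [IsManifold (𝓡∂ 3) ∞ M] [T2Space M] [CompactSpace M]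
    [MeasurableSpace M] [BorelSpace M] (g : L2Rep.Metric3 M) :
    L2Rep.IsRealInnerProduct (L2Rep.muL2 g) ∧
    L2Rep.Dominates (L2Rep.muL2 g) (L2Rep.sigmaC g) (L2Rep.sigmaS g) ∧
    ∃ φ : L2Rep.CStarTensor (L2Rep.WeylAlgebra (L2Rep.sigmaC g))
        (L2Rep.WeylAlgebra (L2Rep.sigmaS g)) →L[ℂ] ℂ,
      L2Rep.IsQuasiFreeWith (L2Rep.sigmaC g) (L2Rep.sigmaS g) (L2Rep.muL2 g) φ ∧
      (∀ φ', L2Rep.IsQuasiFreeWith (L2Rep.sigmaC g) (L2Rep.sigmaS g) (L2Rep.muL2 g) φ' → φ' = φ) ∧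
      L2Rep.HasFockRepresentation (L2Rep.sigmaC g) (L2Rep.sigmaS g) (L2Rep.muL2 g) φ := by
  exact L2Rep.exists_quasiFree_halfSumForm (L2Rep.isRealInnerProduct_loopPairing g)
    (L2Rep.isRealInnerProduct_boundaryPairing g)
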